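/- Let $P\subset\mathbb{R}^3$ be a lattice $3$-polytope of size $5$, that is, the convex hull of finitely many points of $\mathbb{Z}^3$, containing four affinely independent points, with exactly five points in $A=P\cap\mathbb{Z}^3$. The affine dependence of the five points of $A$ is unique up to a nonzero factor; $P$ has signature $(i,j)$ (equivalently $(j,i)$) if this dependence has $i$ positive and $j$ negative coefficients. The volume vector of $p_1,\dots,p_5$ is the dependence $(v_1,\dots,v_5)$ with $v_k=(-1)^{k-1}\det\begin{pmatrix}1&1&1&1\\ p_a&p_b&p_c&p_d\end{pmatrix}$, where $a<b<c<d$ are the indices other than $k$; the (normalized) volume of a tetrahedron is the absolute value of the corresponding determinant. An integer affine functional is an affine map $f:\mathbb{R}^3\to\mathbb{R}$ with $f(\mathbb{Z}^3)\subseteq\mathbb{Z}$, and the width of $P$ is the minimum of $\max_P f-\min_P f$ over all non-constant integer affine functionals $f$. An empty tetrahedron is a lattice $3$-polytope with exactly four lattice points. 1. If $P$ has signature $(2,2)$, $(2,1)$ or $(3,2)$, then $P$ has width one. 2. If $P$ has signature $(3,1)$ or $(4,1)$, then $P$ contains empty tetrahedra and one of them has largest volume; and for every empty tetrahedron $T\subseteq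 P$ of largest volume $q\ge 1$ among the empty tetrahedra contained in $P$, there are an integer affine functional $f$ and an $h\in\{-1,-2\}$ such that $f$ takes the values $1,1,0,0$, in some order, on the four vertices of $T$ and the value $h$ on the fifth point of $A$. Moreover, for every such $T$, $f$ and $h$: for some ordering of $A$ the volume vector of $P$ is of the symmetric form $(q',q',q',q',-4q')$ with an integer $q'\ge 1$ if and only if $P$ has signature $(4,1)$ and $h=-2$; and in that case $q'=q$ is the volume of $T$. -/

import Mathlib

/-- The inclusion of the lattice `ℤ³` into `ℝ³`. -/
def toReal3 (x : Fin 3 → ℤ) : Fin 3 → ℝ := fun i => (x i : ℝ)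

/-- The lattice points `P ∩ ℤ³` of a subset `P` of `ℝ³`. -/
def latticePoints (P : Set (Fin 3 → ℝ)) : Set (Fin 3 → ℤ) := {x | toReal3 x ∈ P}

/-- A lattice `3`-polytope: the convex hull of a finite set of points of `ℤ³`, containing four
affinely independent points. -/
def IsLattice3Polytope (P : Set (Fin 3 → ℝ)) : Prop :=
  (∃ S : Finset (Fin 3 → ℤ), P = convexHull ℝ (toReal3 '' (S : Set (Fin 3 → ℤ)))) ∧
  ∃ x : Fin 4 → Fin 3 → ℝ, AffineIndependent ℝ x ∧ ∀ i, x i ∈ P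

/-- The size of `P`: its number of lattice points. -/
noncomputable def latticeSize (P : Set (Fin 3 → ℝ)) : ℕ := (latticePoints P).ncard

/-- An integer affine functional: an affine map `f : ℝ³ → ℝ` with `f(ℤ³) ⊆ ℤ`. -/
def IsIntegerFunctional (f : (Fin 3 → ℝ) →ᵃ[ℝ] ℝ) : Prop :=
  ∀ x : Fin 3 → ℤ, ∃ n : ℤ, f (toReal3 x) = n

/-- The width of `P` with respect to `f` is `w`: `max_P f - min_P f = w`. -/
def HasWidthWrt (P : Set (Fin 3 → ℝ)) (f : (Fin 3 → ℝ) →ᵃ[ℝ] ℝ) (w : ℝ) : Prop :=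
  ∃ M m : ℝ, IsGreatest (f '' P) M ∧ IsLeast (f '' P) m ∧ w = M - m

/-- The width of `P` is `w`: the minimum of the widths of `P` with respect to the non-constant
integer affine functionals is `w`. -/
def HasWidth (P : Set (Fin 3 → ℝ)) (w : ℝ) : Prop :=
  IsLeast {u : ℝ | ∃ f : (Fin 3 → ℝ) →ᵃ[ℝ] ℝ,
    IsIntegerFunctional f ∧ (∃ x y, f x ≠ f y) ∧ HasWidthWrt P f u} w

/-- `p` lists the lattice points of `P`, each exactly once (so `P` has size five). -/
def IsListing (P : Set (Fin 3 → ℝ)) (p : Fin 5 → Fin 3 → ℤ) : Prop :=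
  Function.Injective p ∧ Set.range p = latticePoints P

/-- `c` is a (non-trivial) affine dependence of the five points `p`. -/
def IsAffineDependence (p : Fin 5 → Fin 3 → ℤ) (c : Fin 5 → ℝ) : Prop :=
  c ≠ 0 ∧ ∑ k, c k = 0 ∧ ∑ k, c k • toReal3 (p k) = 0

/-- The signature of the size five polytope `P` is `(i, j)`: the affine dependence of its lattice
points has `i` positive and `j` negative coefficients. The dependence is unique up to a nonzero
factor of either sign, so `(i, j)` and `(j, i)` are the same signature. -/
def HasSignature (P : Set (Fin 3 → ℝ)) (i j : ℕ) : Prop :=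
  ∃ p : Fin 5 → Fin 3 → ℤ, IsListing P p ∧ ∃ c : Fin 5 → ℝ, IsAffineDependence p c ∧
    {k | 0 < c k}.ncard = i ∧ {k | c k < 0}.ncard = j

/-- The determinant of the matrix with columns `(1, t j)`, `j = 0, 1, 2, 3`. -/
def homogeneousDet (t : Fin 4 → Fin 3 → ℤ) : ℤ :=
  (Matrix.of fun i j : Fin 4 => (Fin.cons 1 (t j) : Fin 4 → ℤ) i).det

/-- The tetrahedron with vertices `t`. -/
def tetrahedron (t : Fin 4 → Fin 3 → ℤ) : Set (Fin 3 → ℝ) :=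
  convexHull ℝ (Set.range fun j => toReal3 (t j))

/-- The normalized volume of the tetrahedron with vertices `t`. -/
def tetrahedronVolume (t : Fin 4 → Fin 3 → ℤ) : ℤ := |homogeneousDet t|

/-- `t` lists the vertices of an empty tetrahedron: the four lattice points are affinely
independent and are the only lattice points of their convex hull. -/
def IsEmptyTetrahedron (t : Fin 4 → Fin 3 → ℤ) : Prop :=
  AffineIndependent ℝ (fun j => toReal3 (t j)) ∧ latticePoints (tetrahedron t) = Set.range t

/-- `t` lists the vertices of an empty tetrahedron contained in `P` whose volume is largest among
all the empty tetrahedra contained in `P`. -/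
def IsLargestEmptyTetrahedron (P : Set (Fin 3 → ℝ)) (t : Fin 4 → Fin 3 → ℤ) : Prop :=
  IsEmptyTetrahedron t ∧ tetrahedron t ⊆ P ∧
  ∀ s : Fin 4 → Fin 3 → ℤ, IsEmptyTetrahedron s → tetrahedron s ⊆ P →
    tetrahedronVolume s ≤ tetrahedronVolume t

/-- The volume vector of five points: the affine dependence whose `k`-th coefficient is, up to
sign, the volume of the tetrahedron spanned by the points other than the `k`-th one. -/
def volumeVector (p : Fin 5 → Fin 3 → ℤ) (k : Fin 5) : ℤ :=
  (-1) ^ (k : ℕ) * homogeneousDet fun j => p (k.succAbove j)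

/-- For a suitable order of the lattice points of `P`, the volume vector is
`(q, q, q, q, -4q)`. -/
def HasSymmetricVolumeVector (P : Set (Fin 3 → ℝ)) (q : ℤ) : Prop :=
  ∃ p : Fin 5 → Fin 3 → ℤ, IsListing P p ∧ volumeVector p = ![q, q, q, q, -4 * q]

/-- The integer affine functional `f` takes the values `1, 1, 0, 0` on the vertices `t` (in some
order), and `h` on the fifth lattice point of `P`. -/
def TakesValues (P : Set (Fin 3 → ℝ)) (t : Fin 4 → Fin 3 → ℤ) (f : (Fin 3 → ℝ) →ᵃ[ℝ] ℝ)
    (h : ℤ) : Prop :=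
  IsIntegerFunctional f ∧
  ∃ p : Fin 5 → Fin 3 → ℤ, IsListing P p ∧ p '' {0, 1, 2, 3} = Set.range t ∧
    f (toReal3 (p 0)) = 1 ∧ f (toReal3 (p 1)) = 1 ∧
    f (toReal3 (p 2)) = 0 ∧ f (toReal3 (p 3)) = 0 ∧ f (toReal3 (p 4)) = h

/-! The engine is White's theorem: for some splitting of the vertices of an empty tetrahedron into
two pairs, the affine functional equal to 1 on one pair and 0 on the other is integral on the
lattice (`IsEmptyBasis.white`). Its proof makes the facets unimodular, so that the lattice is
described by two residues modulo an integer, and emptiness becomes an inequality on residues. This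
forces one of three congruences (`dvd_of_residue_sum_lt`), by a floor-function argument.

Let `c` be the affine dependence of the five points. The tetrahedron omitting point `k` is empty
exactly when some other coefficient has the sign of `c k` (`IsListing.isEmptyTetrahedron_iff`), and
its volume is proportional to `|c k|`. A White functional equal to 1 on vertices `i`, `j` takes the
value `-(c i + c j) / c k` at the omitted point, and this value is an integer.

For signatures (2,2), (2,1) and (3,2), a point with a suitably large coefficient is omitted. Size
estimates then usually place the value strictly between -1 and 2, so it is 0 or 1 and the width is
one. The estimates fail only when coefficients tie. A tie is resolved by omitting another point, and
if that also fails, by combining the two functionals into one that works.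

For signatures (3,1) and (4,1), a largest empty tetrahedron omits a point of maximal positive
coefficient. One takes the pair of the splitting that avoids the point of negative coefficient; the
value then lies in `[-2, 0)`. The value -2 forces three equal maximal coefficients. In signature
(4,1) the fourth positive one must agree with them, since otherwise there is a sixth lattice point
(`coeff_eq_of_lattice`). -/

/-! ### Floor sums and the arithmetic of White's theorem -/

/-- View `k * x / n` as a counter that jumps as `k` grows; every jump of the `a`-counter must be a
jump of exactly one of the other two. The first `a`-jump, at `m`, is a `b`-jump. Around the first
`c`-jump `t`, the `a`-counter moves too slowly to pay for both the `c`-jump and the `b`-jump that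
`m` steps must contain. -/
lemma floorStep_aux {n a b c m : ℤ} (hn : 0 < n) (hc : 2 ≤ c) (hcn : c < n) (h2a : 2 * a < n)
    (hbc : b + c = a + 1) (hb : 2 ≤ b) (hm : n ≤ m * a) (hm' : (m - 1) * a < n)
    (hmb : n ≤ m * b)
    (hF : ∀ k, 0 < k → k < n → k * b / n + k * c / n = k * a / n) : False := by
  have ha : 3 ≤ a := by omega
  have hm3 : 3 ≤ m := by
    by_contra h
    have : m * a ≤ 2 * a := by nlinarith
    omega
  have hmn : m < n := by nlinarith
  obtain ⟨t, ht, ht'⟩ : ∃ t, n ≤ t * c ∧ (t - 1) * c < n := by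
    refine ⟨(n + c - 1) / c, ?_, ?_⟩
    · have := Int.emod_add_mul_ediv (n + c - 1) c
      have h1 := Int.emod_lt_of_pos (n + c - 1) (by omega : 0 < c)
      nlinarith
    · have := Int.emod_add_mul_ediv (n + c - 1) c
      have h1 := Int.emod_nonneg (n + c - 1) (by omega : c ≠ 0)
      nlinarith
  have key : ∀ {k x j : ℤ}, j ≤ k * x / n ↔ j * n ≤ k * x := fun {k x j} =>
    Int.le_ediv_iff_mul_le hn
  have key' : ∀ {k x j : ℤ}, k * x / n < j ↔ k * x < j * n := fun {k x j} =>
    Int.ediv_lt_iff_lt_mul hn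
  -- Otherwise both counters have reached 1 at time `m`, where the `a`-counter is still below 2.
  have hmt : m < t := by
    by_contra h
    have h1 := hF m (by omega) hmn
    have h2 : 1 ≤ m * b / n := key.2 (by linarith)
    have h3 : 1 ≤ m * c / n := key.2 (by nlinarith)
    have h4 : m * a / n < 2 := key'.2 (by nlinarith)
    omega
  have htn : t + 1 < n := by
    have : (t - 1) * 2 ≤ (t - 1) * c := by nlinarith
    omega
  have hjump : ∀ {x y z : ℤ}, (z - y) * x ≤ n - 1 → z * x / n ≤ y * x / n + 1 := by
    intro x y z h
    have h1 : z * x / n < y * x / n + 2 := by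
      refine key'.2 ?_
      have h2 : y * x < (y * x / n + 1) * n := key'.1 (by omega)
      nlinarith
    omega
  -- Comparing `t - 1` with `t + 1`, and `t - m + 1` with `t`, the single possible `a`-jump is used
  -- up by `c`. So `b` is constant from `t - m + 1` to `t + 1`, which are `m` steps, against `n ≤ m
  -- * b`.
  have e1 := hF (t - m + 1) (by omega) (by omega)
  have e2 := hF t (by omega) (by omega)
  have e3 := hF (t - 1) (by omega) (by omega)
  have e4 := hF (t + 1) (by omega) (by omega)
  have c1 : (t - m + 1) * c / n < 1 := key'.2 (by nlinarith)
  have c2 : 1 ≤ t * c / n := key.2 (by linarith)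
  have c3 : (t - 1) * c / n < 1 := key'.2 (by linarith)
  have c4 : 1 ≤ (t + 1) * c / n := key.2 (by nlinarith)
  have c1' : 0 ≤ (t - m + 1) * c / n := key.2 (by nlinarith)
  have c3' : 0 ≤ (t - 1) * c / n := key.2 (by nlinarith)
  have a1 : t * a / n ≤ (t - m + 1) * a / n + 1 := hjump (by linarith)
  have a2 : (t + 1) * a / n ≤ (t - 1) * a / n + 1 := hjump (by linarith)
  have b1 : (t - 1) * b / n ≤ t * b / n := Int.ediv_le_ediv hn (by nlinarith)
  have b2 : (t - m + 1) * b / n + 1 ≤ (t + 1) * b / n := by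
    refine key.2 ?_
    have := (key (k := t - m + 1) (x := b)).1 le_rfl
    linarith
  omega

/-- Passing from `a` to `n - a` turns the three-term identity into the two-term one of
`floorStep_aux`. The first jump of `n - a` belongs to `b` or to `c`, which play symmetric roles. -/
lemma floorPartition_aux {n a b c : ℤ} (ha : a < n) (hb : 2 ≤ b) (hc : 2 ≤ c)
    (hbn : b < n) (hcn : c < n) (hsum : a + b + c = n + 1) (h2a : n ≤ 2 * a)
    (hnz : ∀ k, 0 < k → k < n → k * a % n ≠ 0)
    (hF : ∀ k, 0 < k → k < n → k * a / n + k * b / n + k * c / n = k - 1) : False := by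
  have hn : 0 < n := by omega
  have hF' : ∀ k, 0 < k → k < n → k * b / n + k * c / n = k * (n - a) / n := by
    intro k h0 hk
    have h1 : k * (n - a) / n = k - 1 - k * a / n := by
      have e := Int.emod_add_mul_ediv (k * a) n
      have h2 := Int.emod_lt_of_pos (k * a) hn
      have h3 := Int.emod_nonneg (k * a) hn.ne'
      have h4 := hnz k h0 hk
      refine (Int.ediv_eq_iff_of_pos hn).2 ⟨?_, ?_⟩ <;> 
      · have : 1 ≤ k * a % n := by omega
        nlinarith
    have := hF k h0 hk
    omega
  have h2 : 2 * (n - a) < n := by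
    have h3 : n ≠ 2 * a := fun h => hnz 2 (by omega) (by omega) (by rw [← h]; exact Int.emod_self)
    omega
  obtain ⟨m, hm, hm'⟩ : ∃ m, n ≤ m * (n - a) ∧ (m - 1) * (n - a) < n := by
    refine ⟨(n + (n - a) - 1) / (n - a), ?_, ?_⟩
    · have := Int.emod_add_mul_ediv (n + (n - a) - 1) (n - a)
      have h1 := Int.emod_lt_of_pos (n + (n - a) - 1) (by omega : 0 < n - a)
      nlinarith
    · have := Int.emod_add_mul_ediv (n + (n - a) - 1) (n - a)
      have h1 := Int.emod_nonneg (n + (n - a) - 1) (by omega : n - a ≠ 0)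
      nlinarith
  by_cases h : n ≤ m * b
  · exact floorStep_aux hn hc hcn h2 (by omega) hb hm hm' h hF'
  · refine floorStep_aux (b := c) (c := b) hn hb hbn h2 (by omega) hc hm hm' ?_
      (fun k h0 hk => by rw [add_comm]; exact hF' k h0 hk)
    have hm0 : 0 < m := by nlinarith
    have hmn : m < n := by nlinarith
    have h1 : 1 ≤ m * (n - a) / n := (Int.le_ediv_iff_mul_le hn).2 (by linarith)
    have h3 : m * b / n < 1 := (Int.ediv_lt_iff_lt_mul hn).2 (by linarith)
    have h4 : 1 ≤ m * c / n := by have := hF' m hm0 hmn; omega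
    have := (Int.le_ediv_iff_mul_le hn).1 h4
    linarith

lemma floorPartition {n a b c : ℤ} (ha : 2 ≤ a) (hb : 2 ≤ b) (hc : 2 ≤ c) (han : a < n)
    (hbn : b < n) (hcn : c < n) (hsum : a + b + c = n + 1)
    (hnz : ∀ k, 0 < k → k < n → k * a % n ≠ 0 ∧ k * b % n ≠ 0 ∧ k * c % n ≠ 0)
    (hF : ∀ k, 0 < k → k < n → k * a / n + k * b / n + k * c / n = k - 1) : False := by
  have hn : 0 < n := by omega
  by_cases h1 : n ≤ 2 * a
  · exact floorPartition_aux han hb hc hbn hcn hsum h1 (fun k h h' => (hnz k h h').1) hF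
  by_cases h2 : n ≤ 2 * b
  · exact floorPartition_aux hbn ha hc han hcn (by omega) h2 (fun k h h' => (hnz k h h').2.1)
      (fun k h h' => by have := hF k h h'; omega)
  by_cases h3 : n ≤ 2 * c
  · exact floorPartition_aux hcn ha hb han hbn (by omega) h3 (fun k h h' => (hnz k h h').2.2)
      (fun k h h' => by have := hF k h h'; omega)
  -- If all three numbers are below `n / 2`, the floors at `k = 2` vanish while their sum should be
  -- 1.
  have h0 := hF 2 (by omega) (by omega)
  rw [Int.ediv_eq_zero_of_lt (by omega) (by omega), Int.ediv_eq_zero_of_lt (by omega) (by omega),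
    Int.ediv_eq_zero_of_lt (by omega) (by omega)] at h0
  omega

/-- The arithmetic form of White's theorem. -/
lemma dvd_of_residue_sum_lt {n X Y : ℤ} (hn : 0 < n)
    (h : ∀ k, 0 < k → k < n → n < k * X % n + k * Y % n + k) :
    n ∣ X + 1 ∨ n ∣ Y + 1 ∨ n ∣ X + Y := by
  rcases (show n = 1 ∨ 1 < n by omega) with rfl | hn1
  · exact Or.inl (one_dvd _)
  have hneg : ∀ k x : ℤ, k * x % n ≠ 0 → (n - k) * x % n = n - k * x % n := by
    intro k x hx
    have e := Int.emod_add_mul_ediv (k * x) n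
    have h2 := Int.emod_lt_of_pos (k * x) hn
    have h3 := Int.emod_nonneg (k * x) hn.ne'
    exact ((Int.ediv_emod_unique hn (q := x - k * x / n - 1)).2
      ⟨by linarith, by omega, by omega⟩).2
  have hneg0 : ∀ k x : ℤ, k * x % n = 0 → (n - k) * x % n = 0 := by
    intro k x hx
    exact Int.emod_eq_zero_of_dvd (by
      rw [sub_mul]; exact dvd_sub (dvd_mul_right _ _) (Int.dvd_of_emod_eq_zero hx))
  have hlt : ∀ x : ℤ, x % n < n := fun x => Int.emod_lt_of_pos x hn
  have hge : ∀ x : ℤ, 0 ≤ x % n := fun x => Int.emod_nonneg x hn.ne'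
  -- The hypothesis at `k` and at `n - k` together excludes zero residues, and then also bounds the
  -- sum above by `2 * n`.
  have hnz : ∀ k, 0 < k → k < n → k * X % n ≠ 0 ∧ k * Y % n ≠ 0 := by
    intro k h0 hk
    have h1 := h k h0 hk
    have h2 := h (n - k) (by omega) (by omega)
    constructor
    · intro hx
      by_cases hy : k * Y % n = 0
      · omega
      · rw [hneg0 k X hx, hneg k Y hy] at h2; omega
    · intro hy
      by_cases hx : k * X % n = 0
      · omega
      · rw [hneg0 k Y hy, hneg k X hx] at h2; omega
  have hbd : ∀ k, 0 < k → k < n → k * X % n + k * Y % n + k < 2 * n := by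
    intro k h0 hk
    have h2 := h (n - k) (by omega) (by omega)
    rw [hneg k X (hnz k h0 hk).1, hneg k Y (hnz k h0 hk).2] at h2
    omega
  -- The residues of `-X`, `-Y` and `1 + X + Y` are chosen so that each of the three desired
  -- divisibilities says that one of them is 1. Otherwise `floorPartition` applies.
  obtain ⟨a, A, hA, ha0, han⟩ : ∃ a A, a = -X + n * A ∧ 0 ≤ a ∧ a < n :=
    ⟨(-X) % n, -((-X) / n), by have := Int.emod_add_mul_ediv (-X) n; linarith, hge _, hlt _⟩
  obtain ⟨b, B, hB, hb0, hbn⟩ : ∃ b B, b = -Y + n * B ∧ 0 ≤ b ∧ b < n :=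
    ⟨(-Y) % n, -((-Y) / n), by have := Int.emod_add_mul_ediv (-Y) n; linarith, hge _, hlt _⟩
  obtain ⟨c, C, hC, hc0, hcn⟩ : ∃ c C, c = 1 + X + Y + n * C ∧ 0 ≤ c ∧ c < n :=
    ⟨(1 + X + Y) % n, -((1 + X + Y) / n),
      by have := Int.emod_add_mul_ediv (1 + X + Y) n; linarith, hge _, hlt _⟩
  have ea : ∀ k, 0 < k → k < n →
      k * a / n = k * A - k * X / n - 1 ∧ k * a % n = n - k * X % n := by
    intro k h0 hk
    have e := Int.emod_add_mul_ediv (k * X) n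
    have h2 := hlt (k * X)
    have h3 := hge (k * X)
    have h4 := (hnz k h0 hk).1
    exact (Int.ediv_emod_unique hn).2 ⟨by rw [hA]; linarith, by omega, by omega⟩
  have eb : ∀ k, 0 < k → k < n →
      k * b / n = k * B - k * Y / n - 1 ∧ k * b % n = n - k * Y % n := by
    intro k h0 hk
    have e := Int.emod_add_mul_ediv (k * Y) n
    have h2 := hlt (k * Y)
    have h3 := hge (k * Y)
    have h4 := (hnz k h0 hk).2
    exact (Int.ediv_emod_unique hn).2 ⟨by rw [hB]; linarith, by omega, by omega⟩
  have ec : ∀ k, 0 < k → k < n → k * c / n = k * C + k * X / n + k * Y / n + 1 ∧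
      k * c % n = k * X % n + k * Y % n + k - n := by
    intro k h0 hk
    have e := Int.emod_add_mul_ediv (k * X) n
    have e' := Int.emod_add_mul_ediv (k * Y) n
    have h2 := h k h0 hk
    have h3 := hbd k h0 hk
    exact (Int.ediv_emod_unique hn).2 ⟨by rw [hC]; linarith, by omega, by omega⟩
  have hsum : a + b + c = n + 1 := by
    have e1 := (ea 1 one_pos hn1).2
    have e2 := (eb 1 one_pos hn1).2
    have e3 := (ec 1 one_pos hn1).2
    rw [one_mul, Int.emod_eq_of_lt (by assumption) (by assumption)] at e1 e2 e3
    omega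
  have hABC : A + B + C = 1 := by
    have : n * (A + B + C) = n * 1 := by linarith
    exact mul_left_cancel₀ hn.ne' this
  by_contra hcon
  push Not at hcon
  obtain ⟨h1, h2, h3⟩ := hcon
  have ne0 : ∀ z : ℤ, 1 * z % n ≠ 0 → z ≠ 0 := by rintro z hz rfl; simp at hz
  have hnz' : ∀ k, 0 < k → k < n → k * a % n ≠ 0 ∧ k * b % n ≠ 0 ∧ k * c % n ≠ 0 := by
    intro k h0 hk
    rw [(ea k h0 hk).2, (eb k h0 hk).2, (ec k h0 hk).2]
    have := hlt (k * X)
    have := hlt (k * Y)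
    have := h k h0 hk
    omega
  obtain ⟨p1, p2, p3⟩ := hnz' 1 one_pos hn1
  have a1 : a ≠ 1 := fun e => h1 ⟨A, by linarith⟩
  have b1 : b ≠ 1 := fun e => h2 ⟨B, by linarith⟩
  have c1 : c ≠ 1 := fun e => h3 ⟨-C, by linarith⟩
  have := ne0 a p1
  have := ne0 b p2
  have := ne0 c p3
  refine floorPartition (by omega) (by omega) (by omega) han hbn hcn hsum hnz' ?_
  intro k h0 hk
  rw [(ea k h0 hk).1, (eb k h0 hk).1, (ec k h0 hk).1]
  linear_combination k * hABC

/-! ### White's theorem for an empty corner of an abstract lattice -/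

/-- Integer multiples `L i = D • λ i` of the coordinates on a lattice `M` with respect to three
vectors `w` that span, with the origin, a simplex without further points of `M`. -/
structure EmptyCorner {M : Type*} [AddCommGroup M] (L : Fin 3 → M →+ ℤ) (w : Fin 3 → M)
    (D : ℤ) : Prop where
  pos : 0 < D
  diag : ∀ i, L i (w i) = D
  off : ∀ i j, i ≠ j → L i (w j) = 0
  inj : ∀ z, (∀ i, L i z = 0) → z = 0
  empty : ∀ z, (∀ i, 0 ≤ L i z) → L 0 z + L 1 z + L 2 z ≤ D → z = 0 ∨ ∃ i, z = w i

namespace EmptyCorner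

variable {M : Type*} [AddCommGroup M] {L : Fin 3 → M →+ ℤ} {w : Fin 3 → M} {D : ℤ}

lemma vertex (h : EmptyCorner L w D) (z : M) (h0 : ∀ i, 0 ≤ L i z)
    (h1 : L 0 z + L 1 z + L 2 z ≤ D) (i : Fin 3) : L i z = 0 ∨ L i z = D := by
  rcases h.empty z h0 h1 with rfl | ⟨j, rfl⟩
  · exact Or.inl (map_zero _)
  · by_cases hij : i = j
    · subst hij; exact Or.inr (h.diag i)
    · exact Or.inl (h.off i j hij)

/-- An empty lattice triangle is unimodular: translate the point into the fundamental parallelogram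
of `w 0` and `w 1`; it or its point reflection lies in the triangle, hence is a vertex. -/
lemma dvd_of_eq_zero (h : EmptyCorner L w D) {z : M} (hz : L 2 z = 0) :
    D ∣ L 0 z ∧ D ∣ L 1 z := by
  have hD := h.pos
  set z' := z - (L 0 z / D) • w 0 - (L 1 z / D) • w 1 with hz'
  have e0 : L 0 z' = L 0 z % D := by
    simp [hz', h.diag, h.off, Int.emod_def, mul_comm]
  have e1 : L 1 z' = L 1 z % D := by
    simp [hz', h.diag, h.off, Int.emod_def, mul_comm]
  have e2 : L 2 z' = 0 := by simp [hz', h.off, hz]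
  have r0 := Int.emod_nonneg (L 0 z) hD.ne'
  have r1 := Int.emod_nonneg (L 1 z) hD.ne'
  have s0 := Int.emod_lt_of_pos (L 0 z) hD
  have s1 := Int.emod_lt_of_pos (L 1 z) hD
  by_cases hs : L 0 z % D + L 1 z % D ≤ D
  · have hv := h.vertex z' (by
      intro i
      fin_cases i
      · exact e0 ▸ r0
      · exact e1 ▸ r1
      · exact e2.ge) (by rw [e0, e1, e2]; simpa using hs)
    have h0 := hv 0
    have h1 := hv 1
    rw [e0] at h0
    rw [e1] at h1
    exact ⟨Int.dvd_of_emod_eq_zero (by omega), Int.dvd_of_emod_eq_zero (by omega)⟩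
  · exfalso
    -- The reflected point is in the triangle with both coordinates strictly positive and less than
    -- `D`, so it cannot be a vertex.
    set z'' := w 0 + w 1 - z' with hz''
    have f0 : L 0 z'' = D - L 0 z % D := by simp [hz'', h.diag, h.off, e0]
    have f1 : L 1 z'' = D - L 1 z % D := by simp [hz'', h.diag, h.off, e1]
    have f2 : L 2 z'' = 0 := by simp [hz'', h.off, e2]
    have hv := h.vertex z'' (by
      intro i
      fin_cases i
      · change 0 ≤ L 0 z''
        omega
      · change 0 ≤ L 1 z''
        omega
      · exact f2.ge) (by omega)
    have h0 := hv 0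
    have h1 := hv 1
    omega

lemma dvd_of_dvd (h : EmptyCorner L w D) {z : M} (hz : D ∣ L 2 z) :
    D ∣ L 0 z ∧ D ∣ L 1 z := by
  obtain ⟨k, hk⟩ := hz
  have := h.dvd_of_eq_zero (z := z - k • w 2) (by simp [h.diag, hk, mul_comm])
  simpa [h.off] using this

/-- A point at the least positive height over the facet. By unimodularity of the facet, it generates
the lattice together with `w 0` and `w 1`. -/
lemma exists_generator (h : EmptyCorner L w D) :
    ∃ e : M, 0 < L 2 e ∧ ∀ z, L 2 e ∣ L 2 z := by
  classical
  have hex : ∃ m : ℕ, 0 < m ∧ ∃ z, L 2 z = m :=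
    ⟨D.toNat, by have := h.pos; omega, w 2, by rw [h.diag]; have := h.pos; omega⟩
  obtain ⟨hpos, e, he⟩ := Nat.find_spec hex
  refine ⟨e, by rw [he]; exact_mod_cast hpos, fun z => ?_⟩
  have hg : 0 < L 2 e := by rw [he]; exact_mod_cast hpos
  have r0 := Int.emod_nonneg (L 2 z) hg.ne'
  have s0 := Int.emod_lt_of_pos (L 2 z) hg
  by_contra hnd
  have hne : L 2 z % L 2 e ≠ 0 := fun h' => hnd (Int.dvd_of_emod_eq_zero h')
  refine Nat.find_min hex (m := (L 2 z % L 2 e).toNat) (by omega)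
    ⟨by omega, z - (L 2 z / L 2 e) • e, ?_⟩
  rw [Int.toNat_of_nonneg r0]
  simp [Int.emod_def, mul_comm]

/-- White's theorem. -/
theorem white (h : EmptyCorner L w D) :
    (∀ z, D ∣ L 0 z + L 2 z) ∨ (∀ z, D ∣ L 1 z + L 2 z) ∨ (∀ z, D ∣ L 0 z + L 1 z) := by
  have hD := h.pos
  obtain ⟨e, hg, hgen⟩ := h.exists_generator
  obtain ⟨n, hn⟩ : L 2 e ∣ D := h.diag 2 ▸ hgen (w 2)
  set g := L 2 e with hgdef
  have hn0 : 0 < n := by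
    by_contra hc
    have : g * n ≤ 0 := mul_nonpos_of_nonneg_of_nonpos hg.le (not_lt.1 hc)
    omega
  have hcoord : ∀ z k, L 2 z = g * k → D ∣ L 0 z - k * L 0 e ∧ D ∣ L 1 z - k * L 1 e := by
    intro z k hk
    have := h.dvd_of_eq_zero (z := z - k • e) (by simp [← hgdef, hk, mul_comm])
    simpa using this
  obtain ⟨⟨X, hX⟩, ⟨Y, hY⟩⟩ : g ∣ L 0 e ∧ g ∣ L 1 e := by
    obtain ⟨h1, h2⟩ := hcoord (w 2) n (by rw [h.diag, hn])
    rw [h.off _ _ (by decide), zero_sub, dvd_neg, hn, mul_comm n] at h1 h2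
    exact ⟨Int.dvd_of_mul_dvd_mul_right hn0.ne' h1, Int.dvd_of_mul_dvd_mul_right hn0.ne' h2⟩
  -- If the residue inequality failed at `k`, reducing `k • e` modulo `w 0` and `w 1` would give a
  -- point of the simplex at height `g * k`, strictly between 0 and `D`.
  have harith := dvd_of_residue_sum_lt (X := X) (Y := Y) hn0 (by
    intro k hk0 hkn
    by_contra hle
    set z := k • e - (k * X / n) • w 0 - (k * Y / n) • w 1 with hz
    have e0 : L 0 z = g * (k * X % n) := by
      simp [hz, h.diag, h.off, Int.emod_def, hX, hn]; ring
    have e1 : L 1 z = g * (k * Y % n) := by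
      simp [hz, h.diag, h.off, Int.emod_def, hY, hn]; ring
    have e2 : L 2 z = g * k := by simp [hz, h.off, ← hgdef, mul_comm]
    have hv := h.vertex z (by
      intro i
      fin_cases i
      · exact e0 ▸ mul_nonneg hg.le (Int.emod_nonneg _ hn0.ne')
      · exact e1 ▸ mul_nonneg hg.le (Int.emod_nonneg _ hn0.ne')
      · exact e2 ▸ mul_nonneg hg.le hk0.le) (by
        rw [e0, e1, e2, hn, ← mul_add, ← mul_add]
        exact mul_le_mul_of_nonneg_left (not_lt.1 hle) hg.le) 2
    rw [e2, hn] at hv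
    rcases hv with hv | hv
    · have := mul_pos hg hk0; omega
    · have := mul_left_cancel₀ hg.ne' hv; omega)
  have hmul : ∀ {a k : ℤ}, n ∣ a → D ∣ k * (g * a) := fun {a k} ha =>
    hn ▸ (mul_dvd_mul_left g ha).mul_left k
  rcases harith with ha | ha | ha
  · refine Or.inl fun z => ?_
    obtain ⟨k, hk⟩ := hgen z
    have := dvd_add (hcoord z k hk).1 (hmul (k := k) ha)
    rw [hX] at this
    rwa [show L 0 z + L 2 z = L 0 z - k * (g * X) + k * (g * (X + 1)) by rw [hk]; ring]
  · refine Or.inr (Or.inl fun z => ?_)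
    obtain ⟨k, hk⟩ := hgen z
    have := dvd_add (hcoord z k hk).2 (hmul (k := k) ha)
    rw [hY] at this
    rwa [show L 1 z + L 2 z = L 1 z - k * (g * Y) + k * (g * (Y + 1)) by rw [hk]; ring]
  · refine Or.inr (Or.inr fun z => ?_)
    obtain ⟨k, hk⟩ := hgen z
    have := dvd_add (dvd_add (hcoord z k hk).1 (hcoord z k hk).2) (hmul (k := k) ha)
    rw [hX, hY] at this
    rwa [show L 0 z + L 1 z = L 0 z - k * (g * X) + (L 1 z - k * (g * Y)) + k * (g * (X + Y)) by
      ring]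

end EmptyCorner

/-! ### Barycentric coordinates of empty tetrahedra -/

lemma toReal3_apply (x : Fin 3 → ℤ) (i : Fin 3) : toReal3 x i = x i := rfl

lemma toReal3_add (x y : Fin 3 → ℤ) : toReal3 (x + y) = toReal3 x + toReal3 y := by
  ext i; simp [toReal3]

lemma toReal3_sub (x y : Fin 3 → ℤ) : toReal3 (x - y) = toReal3 x - toReal3 y := by
  ext i; simp [toReal3]

lemma toReal3_zsmul (n : ℤ) (x : Fin 3 → ℤ) : toReal3 (n • x) = (n : ℝ) • toReal3 x := by
  ext i; simp [toReal3]

lemma toReal3_injective : Function.Injective toReal3 := by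
  intro x y h
  ext i
  have := congrFun h i
  simpa [toReal3] using this

/-- The matrix whose determinant is `homogeneousDet t`. -/
def homogeneousMatrix (t : Fin 4 → Fin 3 → ℤ) : Matrix (Fin 4) (Fin 4) ℤ :=
  Matrix.of fun i j : Fin 4 => (Fin.cons 1 (t j) : Fin 4 → ℤ) i

lemma homogeneousMatrix_mulVec_zero (t : Fin 4 → Fin 3 → ℤ) (w : Fin 4 → ℤ) :
    (homogeneousMatrix t).mulVec w 0 = ∑ j, w j := by
  simp [homogeneousMatrix, Matrix.mulVec, dotProduct]

lemma homogeneousMatrix_mulVec_succ (t : Fin 4 → Fin 3 → ℤ) (w : Fin 4 → ℤ) (i : Fin 3) :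
    (homogeneousMatrix t).mulVec w i.succ = ∑ j, w j * t j i := by
  simp [homogeneousMatrix, Matrix.mulVec, dotProduct, mul_comm]

lemma homogeneousDet_ne_zero {t : Fin 4 → Fin 3 → ℤ}
    (ht : AffineIndependent ℝ (fun j => toReal3 (t j))) : homogeneousDet t ≠ 0 := by
  intro h0
  obtain ⟨w, hw, hw0⟩ := (Matrix.exists_mulVec_eq_zero_iff (M := homogeneousMatrix t)).2 h0
  rw [affineIndependent_iff] at ht
  refine hw (funext fun j => ?_)
  have h1 := homogeneousMatrix_mulVec_zero t w
  rw [hw0] at h1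
  have := ht Finset.univ (fun j => (w j : ℝ)) (by exact_mod_cast h1.symm) (by
    ext i
    have h2 := homogeneousMatrix_mulVec_succ t w i
    rw [hw0] at h2
    simp only [Finset.sum_apply, Pi.smul_apply, toReal3_apply, smul_eq_mul, Pi.zero_apply]
    exact_mod_cast h2.symm) j (Finset.mem_univ j)
  exact_mod_cast this

/-- An affine basis of `ℝ³` of lattice points, whose simplex has no further lattice points. -/
structure IsEmptyBasis (b : AffineBasis (Fin 4) ℝ (Fin 3 → ℝ)) (t : Fin 4 → Fin 3 → ℤ) :
    Prop where
  vertex : ∀ i, b i = toReal3 (t i)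
  empty : ∀ z, (∀ i, 0 ≤ b.coord i (toReal3 z)) → ∃ i, z = t i
  denom : ∃ D : ℤ, 0 < D ∧ ∀ i z, ∃ m : ℤ, D * b.coord i (toReal3 z) = m

lemma AffineBasis.coord_eq_of_sum {b : AffineBasis (Fin 4) ℝ (Fin 3 → ℝ)} {w : Fin 4 → ℝ}
    {x : Fin 3 → ℝ} (h1 : ∑ j, w j = 1) (hx : ∑ j, w j • b j = x) (i : Fin 4) :
    b.coord i x = w i := by
  rw [← hx, ← Finset.affineCombination_eq_linear_combination _ _ _ h1,
    b.coord_apply_combination_of_mem (Finset.mem_univ i) h1]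

lemma exists_isEmptyBasis {t : Fin 4 → Fin 3 → ℤ} (ht : IsEmptyTetrahedron t) :
    ∃ b, IsEmptyBasis b t := by
  obtain ⟨hind, hemp⟩ := ht
  have hdet := homogeneousDet_ne_zero hind
  let b : AffineBasis (Fin 4) ℝ (Fin 3 → ℝ) :=
    ⟨fun j => toReal3 (t j), hind,
      hind.affineSpan_eq_top_iff_card_eq_finrank_add_one.2 (by simp)⟩
  have hb : ∀ i, b i = toReal3 (t i) := fun i => rfl
  -- By Cramer's rule the determinant is a common denominator; squaring makes it positive.
  refine ⟨b, hb, fun z hz => ?_, (homogeneousDet t) ^ 2, by positivity, fun i z => ?_⟩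
  · have : toReal3 z ∈ tetrahedron t := by
      have h2 := b.convexHull_eq_nonneg_coord
      change toReal3 z ∈ convexHull ℝ (Set.range b)
      rw [h2]
      exact hz
    have : z ∈ latticePoints (tetrahedron t) := this
    rw [hemp] at this
    obtain ⟨i, hi⟩ := this
    exact ⟨i, hi.symm⟩
  · set w := (homogeneousMatrix t).adjugate.mulVec (Fin.cons 1 z) with hw
    have hmul : (homogeneousMatrix t).mulVec w = homogeneousDet t • (Fin.cons 1 z : Fin 4 → ℤ) := by
      rw [hw, Matrix.mulVec_mulVec, Matrix.mul_adjugate, Matrix.smul_mulVec, Matrix.one_mulVec]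
      rfl
    have hdet' : (homogeneousDet t : ℝ) ≠ 0 := by exact_mod_cast hdet
    have hc := AffineBasis.coord_eq_of_sum (b := b)
      (w := fun j => (w j : ℝ) / homogeneousDet t) (x := toReal3 z) (by
        rw [← Finset.sum_div, div_eq_one_iff_eq hdet']
        have := homogeneousMatrix_mulVec_zero t w
        rw [hmul] at this
        simp only [Pi.smul_apply, Fin.cons_zero, smul_eq_mul, mul_one] at this
        exact_mod_cast this.symm) (by
        ext k
        have := homogeneousMatrix_mulVec_succ t w k
        rw [hmul] at this
        simp only [Pi.smul_apply, Fin.cons_succ, smul_eq_mul] at this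
        simp only [Finset.sum_apply, Pi.smul_apply, hb, toReal3_apply, smul_eq_mul, div_mul_eq_mul_div]
        rw [← Finset.sum_div, div_eq_iff hdet', mul_comm]
        exact_mod_cast this.symm) i
    refine ⟨homogeneousDet t * w i, ?_⟩
    rw [hc]
    push_cast
    field_simp

lemma exists_eq_intCast_iff_dvd {D : ℤ} (hD : 0 < D) {y : ℝ} {m : ℤ}
    (hL : (m : ℝ) = D * y) : (∃ k : ℤ, y = k) ↔ D ∣ m := by
  have hD' : (D : ℝ) ≠ 0 := by exact_mod_cast hD.ne'
  constructor
  · rintro ⟨k, rfl⟩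
    exact ⟨k, by exact_mod_cast hL⟩
  · rintro ⟨k, rfl⟩
    push_cast at hL
    exact ⟨k, (mul_left_cancel₀ hD' hL).symm⟩

lemma AffineBasis.affineMap_eq_sum (b : AffineBasis (Fin 4) ℝ (Fin 3 → ℝ))
    (f : (Fin 3 → ℝ) →ᵃ[ℝ] ℝ) (x : Fin 3 → ℝ) : f x = ∑ i, b.coord i x * f (b i) := by
  have h1 := b.sum_coord_apply_eq_one x
  conv_lhs => rw [← b.affineCombination_coord_eq_self x, Finset.map_affineCombination _ _ _ h1,
    Finset.affineCombination_eq_linear_combination _ _ _ h1]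
  rfl

namespace IsEmptyBasis

variable {b : AffineBasis (Fin 4) ℝ (Fin 3 → ℝ)} {t : Fin 4 → Fin 3 → ℤ}

lemma reindex (h : IsEmptyBasis b t) (σ : Equiv.Perm (Fin 4)) :
    IsEmptyBasis (b.reindex σ) (t ∘ σ.symm) where
  vertex i := by simp [h.vertex]
  empty z hz := by
    obtain ⟨i, hi⟩ := h.empty z fun i => by simpa using hz (σ i)
    exact ⟨σ i, by simpa using hi⟩
  denom := by
    obtain ⟨D, hD, hm⟩ := h.denom
    exact ⟨D, hD, fun i z => by simpa using hm (σ.symm i) z⟩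

lemma coord_vertex (h : IsEmptyBasis b t) (i j : Fin 4) :
    b.coord i (toReal3 (t j)) = if i = j then 1 else 0 := by
  rw [← h.vertex, b.coord_apply]

lemma linear_coord (h : IsEmptyBasis b t) {i : Fin 4} (hi : i ≠ 0) (z : Fin 3 → ℤ) :
    (b.coord i).linear (toReal3 z) = b.coord i (toReal3 (z + t 0)) := by
  have := (b.coord i).map_vadd (toReal3 (t 0)) (toReal3 z)
  simp only [vadd_eq_add, h.coord_vertex, if_neg hi, add_zero] at this
  rw [toReal3_add, this]

lemma exists_emptyCorner (h : IsEmptyBasis b t) :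
    ∃ D : ℤ, ∃ L : Fin 3 → (Fin 3 → ℤ) →+ ℤ, EmptyCorner L (fun i => t i.succ - t 0) D ∧
      ∀ i z, (L i (z - t 0) : ℝ) = D * b.coord i.succ (toReal3 z) := by
  obtain ⟨D, hD, hm⟩ := h.denom
  choose l hl using fun (i : Fin 3) (z : Fin 3 → ℤ) => hm i.succ (z + t 0)
  simp only [← h.linear_coord (Fin.succ_ne_zero _)] at hl
  let L : Fin 3 → (Fin 3 → ℤ) →+ ℤ := fun i => AddMonoidHom.mk' (l i) fun x y => by
    have : (l i (x + y) : ℝ) = l i x + l i y := by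
      rw [← hl, ← hl, ← hl, toReal3_add, map_add, mul_add]
    exact_mod_cast this
  have hD' : (D : ℝ) ≠ 0 := by exact_mod_cast hD.ne'
  have hL : ∀ i z, (L i (z - t 0) : ℝ) = D * b.coord i.succ (toReal3 z) := by
    intro i z
    change (l i (z - t 0) : ℝ) = _
    rw [← hl, h.linear_coord (Fin.succ_ne_zero _), sub_add_cancel]
  have hvert : ∀ i j, (L i (t j.succ - t 0) : ℝ) = if i = j then (D : ℝ) else 0 := by
    intro i j
    rw [hL, h.coord_vertex]
    simp
  have hsum : ∀ z, b.coord 0 z = 1 - b.coord 1 z - b.coord 2 z - b.coord 3 z := by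
    intro z
    have := b.sum_coord_apply_eq_one z
    rw [Fin.sum_univ_four] at this
    linarith
  refine ⟨D, L, ⟨hD, fun i => ?_, fun i j hij => ?_, fun z hz => ?_, fun z hz hs => ?_⟩, hL⟩
  · have := hvert i i
    rw [if_pos rfl] at this
    exact_mod_cast this
  · have := hvert i j
    rw [if_neg hij] at this
    exact_mod_cast this
  · have hc : ∀ i : Fin 3, b.coord i.succ (toReal3 (z + t 0)) = 0 := by
      intro i
      have := hL i (z + t 0)
      rw [add_sub_cancel_right, hz] at this
      simpa [hD'] using this.symm
    have : toReal3 (z + t 0) = toReal3 (t 0) := by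
      refine b.ext_elem fun i => ?_
      have h1 : b.coord 1 (toReal3 (z + t 0)) = 0 := hc 0
      have h2 : b.coord 2 (toReal3 (z + t 0)) = 0 := hc 1
      have h3 : b.coord 3 (toReal3 (z + t 0)) = 0 := hc 2
      refine Fin.cases ?_ (fun j => ?_) i
      · rw [hsum, h1, h2, h3, h.coord_vertex]; simp
      · rw [hc, h.coord_vertex]; simp [Fin.succ_ne_zero]
    simpa using toReal3_injective this
  · have hDp : (0 : ℝ) < D := by exact_mod_cast hD
    have hc : ∀ i, (L i z : ℝ) = D * b.coord i.succ (toReal3 (z + t 0)) := by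
      intro i
      rw [← hL, add_sub_cancel_right]
    obtain ⟨i, hi⟩ := h.empty (z + t 0) (by
      intro i
      refine Fin.cases ?_ (fun j => ?_) i
      · have hs' : (L 0 z : ℝ) + L 1 z + L 2 z ≤ D := by exact_mod_cast hs
        rw [hc, hc, hc] at hs'
        rw [hsum]
        have : 0 ≤ (D : ℝ) * (1 - b.coord 1 (toReal3 (z + t 0)) - b.coord 2 (toReal3 (z + t 0))
          - b.coord 3 (toReal3 (z + t 0))) := by
          simp only [Fin.succ_zero_eq_one, Fin.succ_one_eq_two] at hs'
          change _ + (D : ℝ) * b.coord 3 _ ≤ _ at hs'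
          linarith
        exact nonneg_of_mul_nonneg_right this hDp
      · have : 0 ≤ (L j z : ℝ) := by exact_mod_cast hz j
        rw [hc] at this
        exact nonneg_of_mul_nonneg_right this hDp)
    revert hi
    refine Fin.cases (fun hi => Or.inl (by simpa using hi)) (fun j hi => Or.inr ⟨j, ?_⟩) i
    rw [← hi, add_sub_cancel_right]

lemma integral_coord_of_three (h : IsEmptyBasis b t) {z : Fin 3 → ℤ}
    (hz : ∃ m : ℤ, b.coord 3 (toReal3 z) = m) (j : Fin 4) :
    ∃ m : ℤ, b.coord j (toReal3 z) = m := by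
  obtain ⟨D, L, hc, hL⟩ := h.exists_emptyCorner
  have key := fun i => exists_eq_intCast_iff_dvd hc.pos (hL i z)
  obtain ⟨h0, h1⟩ := hc.dvd_of_dvd ((key 2).1 hz)
  obtain ⟨m3, h3⟩ := hz
  obtain ⟨m1, h1⟩ := (key 0).2 h0
  obtain ⟨m2, h2⟩ := (key 1).2 (by assumption)
  have hs := b.sum_coord_apply_eq_one (toReal3 z)
  rw [Fin.sum_univ_four] at hs
  simp only [Fin.succ_zero_eq_one, Fin.succ_one_eq_two] at h1 h2
  fin_cases j
  · exact ⟨1 - m1 - m2 - m3, by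
      change b.coord 0 (toReal3 z) = _
      push_cast
      linarith⟩
  · exact ⟨m1, h1⟩
  · exact ⟨m2, h2⟩
  · exact ⟨m3, h3⟩

/-- The facets of an empty tetrahedron are unimodular. -/
lemma integral_coord (h : IsEmptyBasis b t) {z : Fin 3 → ℤ} (i : Fin 4)
    (hz : ∃ m : ℤ, b.coord i (toReal3 z) = m) (j : Fin 4) :
    ∃ m : ℤ, b.coord j (toReal3 z) = m := by
  have := (h.reindex (Equiv.swap i 3)).integral_coord_of_three (z := z) (by simpa using hz)
    (Equiv.swap i 3 j)
  simpa using this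

lemma coord_two_zsmul_sub (h : IsEmptyBasis b t) (z : Fin 3 → ℤ) (i j : Fin 4) :
    b.coord j (toReal3 ((2 : ℤ) • z - t i)) =
      2 * b.coord j (toReal3 z) - if j = i then 1 else 0 := by
  have e : toReal3 ((2 : ℤ) • z - t i) = (toReal3 z -ᵥ toReal3 (t i)) +ᵥ toReal3 z := by
    rw [toReal3_sub, toReal3_zsmul, vsub_eq_sub, vadd_eq_add]
    push_cast
    module
  rw [e, (b.coord j).map_vadd, (b.coord j).linearMap_vsub, h.coord_vertex, vsub_eq_sub,
    vadd_eq_add]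
  ring

/-- At a lattice point either all coordinates are integers or none is. In the second case both
coordinates are odd halves: doubling the point makes coordinate `i` integral, hence also coordinate
`j`. -/
lemma isIntegerFunctional_add_of_two_mul (h : IsEmptyBasis b t) {i : Fin 4}
    (hi : ∀ z, ∃ m : ℤ, 2 * b.coord i (toReal3 z) = m) (j : Fin 4) :
    IsIntegerFunctional (b.coord i + b.coord j) := by
  intro z
  change ∃ n : ℤ, b.coord i (toReal3 z) + b.coord j (toReal3 z) = n
  by_cases hz : ∃ m : ℤ, b.coord i (toReal3 z) = m
  · obtain ⟨m, hm⟩ := hz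
    obtain ⟨l, hl⟩ := h.integral_coord i ⟨m, hm⟩ j
    exact ⟨m + l, by push_cast; rw [hm, hl]⟩
  · have hzj : ¬ ∃ m : ℤ, b.coord j (toReal3 z) = m := fun hj => hz (h.integral_coord j hj i)
    obtain ⟨m, hm⟩ := hi z
    obtain ⟨l, hl⟩ := h.integral_coord (z := (2 : ℤ) • z - t 0) i
      ⟨m - if i = 0 then 1 else 0, by rw [h.coord_two_zsmul_sub, hm]; push_cast; rfl⟩ j
    rw [h.coord_two_zsmul_sub] at hl
    have hodd : ∀ {y : ℝ} {a : ℤ}, (¬ ∃ m : ℤ, y = m) → 2 * y = a → a % 2 = 1 := by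
      intro y a hy ha
      by_contra hne
      obtain ⟨d, hd⟩ : ∃ d, a = 2 * d := ⟨a / 2, by omega⟩
      refine hy ⟨d, ?_⟩
      rw [hd] at ha
      push_cast at ha
      linarith
    have h1 := hodd hz hm
    have hl' : 2 * b.coord j (toReal3 z) = ((l + if j = 0 then 1 else 0 : ℤ) : ℝ) := by
      push_cast
      linarith
    have h2 := hodd hzj hl'
    obtain ⟨d, hd⟩ : ∃ d, m + (l + if j = 0 then 1 else 0) = 2 * d :=
      ⟨(m + (l + if j = 0 then 1 else 0)) / 2, by omega⟩
    refine ⟨d, ?_⟩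
    have : ((m + (l + if j = 0 then 1 else 0) : ℤ) : ℝ) = 2 * d := by
      rw [hd]
      push_cast
      rfl
    rw [Int.cast_add, ← hl', ← hm] at this
    linarith

/-- White's theorem: an empty tetrahedron has width one with respect to a functional that
separates two vertices from the other two. -/
theorem white (h : IsEmptyBasis b t) :
    IsIntegerFunctional (b.coord 1 + b.coord 2) ∨ IsIntegerFunctional (b.coord 1 + b.coord 3) ∨
      IsIntegerFunctional (b.coord 2 + b.coord 3) := by
  obtain ⟨D, L, hc, hL⟩ := h.exists_emptyCorner
  have key : ∀ i j : Fin 3, (∀ z, D ∣ L i z + L j z) →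
      IsIntegerFunctional (b.coord i.succ + b.coord j.succ) := by
    intro i j hd z
    refine (exists_eq_intCast_iff_dvd hc.pos ?_).2 (hd (z - t 0))
    push_cast
    rw [hL, hL, ← mul_add]
    rfl
  rcases hc.white with hw | hw | hw
  · exact Or.inr (Or.inl (key 0 2 hw))
  · exact Or.inr (Or.inr (key 1 2 hw))
  · exact Or.inl (key 0 1 hw)

end IsEmptyBasis

/-! ### Five lattice points and their affine dependence -/

lemma IsListing.mem {P : Set (Fin 3 → ℝ)} {p : Fin 5 → Fin 3 → ℤ} (hp : IsListing P p)
    (k : Fin 5) : toReal3 (p k) ∈ P := by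
  have : p k ∈ latticePoints P := hp.2 ▸ Set.mem_range_self k
  exact this

lemma IsListing.exists_eq {P : Set (Fin 3 → ℝ)} {p : Fin 5 → Fin 3 → ℤ} (hp : IsListing P p)
    {z : Fin 3 → ℤ} (hz : toReal3 z ∈ P) : ∃ k, p k = z := by
  have : z ∈ latticePoints P := hz
  rwa [← hp.2] at this

lemma IsListing.comp {P : Set (Fin 3 → ℝ)} {p : Fin 5 → Fin 3 → ℤ} (hp : IsListing P p)
    {σ : Fin 5 → Fin 5} (hσ : Function.Injective σ) : IsListing P (p ∘ σ) :=
  ⟨hp.1.comp hσ, by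
    rw [Set.range_comp, (Finite.injective_iff_surjective.1 hσ).range_eq, Set.image_univ, hp.2]⟩

lemma IsListing.exists_perm {P : Set (Fin 3 → ℝ)} {p p' : Fin 5 → Fin 3 → ℤ}
    (hp : IsListing P p) (hp' : IsListing P p') : ∃ σ : Equiv.Perm (Fin 5), p' = p ∘ σ := by
  choose σ hσ using fun k => hp.exists_eq (hp'.mem k)
  have hinj : Function.Injective σ := fun i j h => hp'.1 (by rw [← hσ, ← hσ, h])
  exact ⟨Equiv.ofBijective σ (Finite.injective_iff_bijective.1 hinj), funext fun k => (hσ k).symm⟩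

lemma IsListing.eq_convexHull {P : Set (Fin 3 → ℝ)} {p : Fin 5 → Fin 3 → ℤ}
    (hp : IsListing P p) (hP : IsLattice3Polytope P) :
    P = convexHull ℝ (Set.range fun k => toReal3 (p k)) := by
  obtain ⟨⟨S, hS⟩, -⟩ := hP
  have hconv : Convex ℝ P := hS ▸ convex_convexHull ℝ _
  refine Set.Subset.antisymm ?_ (convexHull_min ?_ hconv)
  · conv_lhs => rw [hS]
    refine convexHull_mono ?_
    rintro _ ⟨z, hz, rfl⟩
    obtain ⟨k, rfl⟩ := hp.exists_eq (z := z) (by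
      rw [hS]; exact subset_convexHull ℝ _ ⟨z, hz, rfl⟩)
    exact ⟨k, rfl⟩
  · rintro _ ⟨k, rfl⟩
    exact hp.mem k

lemma IsListing.affineSpan_eq_top {P : Set (Fin 3 → ℝ)} {p : Fin 5 → Fin 3 → ℤ}
    (hp : IsListing P p) (hP : IsLattice3Polytope P) :
    affineSpan ℝ (Set.range fun k => toReal3 (p k)) = ⊤ := by
  have hull := hp.eq_convexHull hP
  obtain ⟨-, x, hx, hxP⟩ := hP
  have htop : affineSpan ℝ (Set.range x) = ⊤ :=
    hx.affineSpan_eq_top_iff_card_eq_finrank_add_one.2 (by simp)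
  rw [eq_top_iff, ← htop, ← affineSpan_convexHull (Set.range fun k => toReal3 (p k)), ← hull]
  refine affineSpan_mono ℝ ?_
  rintro _ ⟨i, rfl⟩
  exact hxP i

lemma IsAffineDependence.comp {p : Fin 5 → Fin 3 → ℤ} {c : Fin 5 → ℝ}
    (hc : IsAffineDependence p c) {σ : Fin 5 → Fin 5} (hσ : Function.Injective σ) :
    IsAffineDependence (p ∘ σ) (c ∘ σ) := by
  have hb : Function.Bijective σ := Finite.injective_iff_bijective.1 hσ
  obtain ⟨h0, h1, h2⟩ := hc
  refine ⟨fun h => h0 (funext fun k => ?_), ?_, ?_⟩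
  · obtain ⟨j, rfl⟩ := hb.2 k
    exact congrFun h j
  · rw [← h1]
    exact hb.sum_comp c
  · rw [← h2]
    exact hb.sum_comp fun k => c k • toReal3 (p k)

lemma IsAffineDependence.neg {p : Fin 5 → Fin 3 → ℤ} {c : Fin 5 → ℝ}
    (hc : IsAffineDependence p c) : IsAffineDependence p (-c) := by
  obtain ⟨h0, h1, h2⟩ := hc
  refine ⟨neg_ne_zero.2 h0, ?_, ?_⟩
  · simp [h1]
  · simp [h2]

lemma sum_mul_affineMap {p : Fin 5 → Fin 3 → ℤ} {c : Fin 5 → ℝ} (h1 : ∑ k, c k = 0)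
    (h2 : ∑ k, c k • toReal3 (p k) = 0) (f : (Fin 3 → ℝ) →ᵃ[ℝ] ℝ) :
    ∑ k, c k * f (toReal3 (p k)) = 0 := by
  have e : ∀ k, c k * f (toReal3 (p k)) = f.linear (c k • toReal3 (p k)) + c k * f 0 := by
    intro k
    have := f.map_vadd 0 (toReal3 (p k))
    simp only [vadd_eq_add, add_zero] at this
    rw [this, map_smul, smul_eq_mul]
    ring
  simp_rw [e]
  rw [Finset.sum_add_distrib, ← map_sum, h2, ← Finset.sum_mul, h1]
  simp

lemma IsListing.affineIndependent {P : Set (Fin 3 → ℝ)} {p : Fin 5 → Fin 3 → ℤ}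
    (hp : IsListing P p) (hP : IsLattice3Polytope P) {c : Fin 5 → ℝ}
    (hc : IsAffineDependence p c) {k : Fin 5} (hk : c k ≠ 0) :
    AffineIndependent ℝ fun j => toReal3 (p (k.succAbove j)) := by
  set s := Set.range fun j => toReal3 (p (k.succAbove j)) with hs
  have htop : affineSpan ℝ s = ⊤ := by
    rw [eq_top_iff, ← hp.affineSpan_eq_top hP]
    refine affineSpan_le.2 ?_
    have hmem : ∀ j, toReal3 (p (k.succAbove j)) ∈ affineSpan ℝ s := fun j =>
      subset_affineSpan ℝ _ ⟨j, rfl⟩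
    rintro _ ⟨i, rfl⟩
    rcases Fin.eq_self_or_eq_succAbove k i with rfl | ⟨j, rfl⟩
    · obtain ⟨-, h1, h2⟩ := hc
      rw [Fin.sum_univ_succAbove _ i] at h1 h2
      have hw : ∑ j, (-(c (i.succAbove j) / c i)) = 1 := by
        rw [Finset.sum_neg_distrib, ← Finset.sum_div, ← neg_div, div_eq_one_iff_eq hk]
        linarith
      have hx : toReal3 (p i) = ∑ j, (-(c (i.succAbove j) / c i)) • toReal3 (p (i.succAbove j)) := by
        have : ∀ j, (-(c (i.succAbove j) / c i)) • toReal3 (p (i.succAbove j)) =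
            (-(c i)⁻¹) • (c (i.succAbove j) • toReal3 (p (i.succAbove j))) := by
          intro j
          rw [smul_smul]
          congr 1
          ring
        simp_rw [this]
        rw [← Finset.smul_sum, ← neg_eq_of_add_eq_zero_right h2, neg_smul, smul_neg, neg_neg,
          smul_smul, inv_mul_cancel₀ hk, one_smul]
      change toReal3 (p i) ∈ affineSpan ℝ s
      rw [hx, ← Finset.affineCombination_eq_linear_combination _ _ _ hw]
      exact affineCombination_mem_affineSpan hw _
    · exact hmem j
  rw [affineIndependent_iff_finrank_vectorSpan_eq ℝ _ (n := 3) (by simp), ← direction_affineSpan,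
    htop, AffineSubspace.direction_top, finrank_top]
  simp

lemma eq_zero_of_affineIndependent {p : Fin 5 → Fin 3 → ℤ} {k : Fin 5}
    (hk : AffineIndependent ℝ fun j => toReal3 (p (k.succAbove j))) {d : Fin 5 → ℝ}
    (h1 : ∑ k, d k = 0) (h2 : ∑ k, d k • toReal3 (p k) = 0) (hd : d k = 0) : d = 0 := by
  rw [Fin.sum_univ_succAbove _ k, hd] at h1 h2
  rw [zero_add] at h1
  rw [zero_smul, zero_add] at h2
  rw [affineIndependent_iff] at hk
  have := hk Finset.univ (fun j => d (k.succAbove j)) h1 h2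
  funext i
  rcases Fin.eq_self_or_eq_succAbove k i with rfl | ⟨j, rfl⟩
  · exact hd
  · exact this j (Finset.mem_univ j)

lemma IsListing.dependence_unique {P : Set (Fin 3 → ℝ)} {p : Fin 5 → Fin 3 → ℤ}
    (hp : IsListing P p) (hP : IsLattice3Polytope P) {c : Fin 5 → ℝ}
    (hc : IsAffineDependence p c) {k : Fin 5} (hk : c k ≠ 0) {d : Fin 5 → ℝ}
    (h1 : ∑ k, d k = 0) (h2 : ∑ k, d k • toReal3 (p k) = 0) (i : Fin 5) :
    d i = d k / c k * c i := by
  have := eq_zero_of_affineIndependent (hp.affineIndependent hP hc hk)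
    (d := fun i => d i - d k / c k * c i) (by
      rw [Finset.sum_sub_distrib, h1, ← Finset.mul_sum, hc.2.1]; simp) (by
      simp_rw [sub_smul, mul_smul]
      rw [Finset.sum_sub_distrib, h2, ← Finset.smul_sum, hc.2.2]; simp) (by
      field_simp; simp)
  exact sub_eq_zero.1 (congrFun this i)

lemma IsListing.tetrahedron_subset {P : Set (Fin 3 → ℝ)} {p : Fin 5 → Fin 3 → ℤ}
    (hp : IsListing P p) (hP : IsLattice3Polytope P) (k : Fin 5) :
    tetrahedron (fun j => p (k.succAbove j)) ⊆ P := by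
  conv_rhs => rw [hp.eq_convexHull hP]
  refine convexHull_mono ?_
  rintro _ ⟨j, rfl⟩
  exact ⟨_, rfl⟩

lemma mem_convexHull_range_iff {x : Fin 3 → ℝ} {v : Fin 4 → Fin 3 → ℝ} :
    x ∈ convexHull ℝ (Set.range v) ↔
      ∃ w : Fin 4 → ℝ, (∀ i, 0 ≤ w i) ∧ ∑ i, w i = 1 ∧ ∑ i, w i • v i = x := by
  constructor
  · intro h
    rw [convexHull_range_eq_exists_affineCombination] at h
    obtain ⟨s, w, hw0, hw1, rfl⟩ := h
    classical
    refine ⟨fun i => if i ∈ s then w i else 0, fun i => ?_, by simpa using hw1, ?_⟩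
    · dsimp only
      split_ifs with hi
      · exact hw0 i hi
      · exact le_rfl
    · rw [Finset.affineCombination_eq_linear_combination _ _ _ hw1]
      simp
  · rintro ⟨w, hw0, hw1, rfl⟩
    exact (convex_convexHull ℝ _).sum_mem (fun i _ => hw0 i) hw1
      fun i _ => subset_convexHull ℝ _ ⟨i, rfl⟩

/-- Only `p k` can spoil emptiness. Solving the dependence for it gives barycentric coordinates `-(c
l / c k)`, which are all nonnegative exactly when no other coefficient has the sign of `c k`. -/
lemma IsListing.isEmptyTetrahedron_iff {P : Set (Fin 3 → ℝ)} {p : Fin 5 → Fin 3 → ℤ}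
    (hp : IsListing P p) (hP : IsLattice3Polytope P) {c : Fin 5 → ℝ}
    (hc : IsAffineDependence p c) (k : Fin 5) :
    IsEmptyTetrahedron (fun j => p (k.succAbove j)) ↔ ∃ l, l ≠ k ∧ 0 < c l * c k := by
  constructor
  · rintro ⟨hind, hemp⟩
    have hk : c k ≠ 0 := fun hk0 =>
      hc.1 (eq_zero_of_affineIndependent hind hc.2.1 hc.2.2 hk0)
    by_contra hcon
    push Not at hcon
    have hmem : p k ∈ latticePoints (tetrahedron fun j => p (k.succAbove j)) := by
      refine mem_convexHull_range_iff.2 ⟨fun j => -(c (k.succAbove j) / c k), fun j => ?_, ?_, ?_⟩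
      · have := hcon (k.succAbove j) (Fin.succAbove_ne k j)
        rw [neg_nonneg, div_eq_mul_inv]
        have e : c (k.succAbove j) * (c k)⁻¹ = c (k.succAbove j) * c k * ((c k)⁻¹) ^ 2 := by
          field_simp
        rw [e]
        exact mul_nonpos_of_nonpos_of_nonneg this (sq_nonneg _)
      · have h1 := hc.2.1
        rw [Fin.sum_univ_succAbove _ k] at h1
        rw [Finset.sum_neg_distrib, ← Finset.sum_div, ← neg_div, div_eq_one_iff_eq hk]
        linarith
      · have h2 := hc.2.2
        rw [Fin.sum_univ_succAbove _ k] at h2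
        have : ∀ j, (-(c (k.succAbove j) / c k)) • toReal3 (p (k.succAbove j)) =
            (-(c k)⁻¹) • (c (k.succAbove j) • toReal3 (p (k.succAbove j))) := by
          intro j
          rw [smul_smul]
          congr 1
          ring
        simp_rw [this]
        rw [← Finset.smul_sum, ← neg_eq_of_add_eq_zero_right h2, neg_smul, smul_neg, neg_neg,
          smul_smul, inv_mul_cancel₀ hk, one_smul]
    rw [hemp] at hmem
    obtain ⟨j, hj⟩ := hmem
    exact Fin.succAbove_ne k j (hp.1 hj)
  · rintro ⟨l, hlk, hl⟩
    have hk : c k ≠ 0 := by rintro h; simp [h] at hl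
    refine ⟨hp.affineIndependent hP hc hk, Set.Subset.antisymm ?_ ?_⟩
    · intro z hz
      obtain ⟨i, rfl⟩ := hp.exists_eq (hp.tetrahedron_subset hP k hz)
      rcases Fin.eq_self_or_eq_succAbove k i with rfl | ⟨j, rfl⟩
      · exfalso
        obtain ⟨w, hw0, hw1, hw⟩ := mem_convexHull_range_iff.1 hz
        obtain ⟨j, rfl⟩ := (Fin.eq_self_or_eq_succAbove i l).resolve_left hlk
        have := hp.dependence_unique hP hc hk
          (d := Fin.insertNth (α := fun _ => ℝ) i 1 fun j => -w j) (by
            rw [Fin.sum_univ_succAbove _ i]; simp [hw1]) (by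
            rw [Fin.sum_univ_succAbove _ i]; simp [hw]) (i.succAbove j)
        simp only [Fin.insertNth_apply_succAbove, Fin.insertNth_apply_same] at this
        have e : 1 / c i * c (i.succAbove j) = c (i.succAbove j) * c i * ((c i)⁻¹) ^ 2 := by
          field_simp
        have h2 : 0 < c (i.succAbove j) * c i * ((c i)⁻¹) ^ 2 :=
          mul_pos hl (by positivity)
        have := hw0 j
        linarith
      · exact ⟨j, rfl⟩
    · rintro _ ⟨j, rfl⟩
      exact subset_convexHull ℝ _ ⟨j, rfl⟩

/-- Fixes the order of the points: two sign patterns with equally large fibres differ by a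
permutation. -/
lemma exists_listing_of_signature {P : Set (Fin 3 → ℝ)} {i j : ℕ} (h : HasSignature P i j)
    (s : Fin 5 → SignType) (hi : Fintype.card {k // s k = 1} = i)
    (hj : Fintype.card {k // s k = -1} = j) :
    ∃ p c, IsListing P p ∧ IsAffineDependence p c ∧ ∀ k, SignType.sign (c k) = s k := by
  classical
  obtain ⟨p, hp, c, hc, hci, hcj⟩ := h
  have h1 : Fintype.card {k // SignType.sign (c k) = 1} = i := by
    rw [← hci, ← Nat.card_coe_set_eq, Nat.card_eq_fintype_card]
    exact Fintype.card_congr (Equiv.subtypeEquivRight fun k => by simp [sign_eq_one_iff])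
  have h2 : Fintype.card {k // SignType.sign (c k) = -1} = j := by
    rw [← hcj, ← Nat.card_coe_set_eq, Nat.card_eq_fintype_card]
    exact Fintype.card_congr (Equiv.subtypeEquivRight fun k => by simp [sign_eq_neg_one_iff])
  have htot : ∀ g : Fin 5 → SignType, Fintype.card {k // g k = 0} + Fintype.card {k // g k = -1} +
      Fintype.card {k // g k = 1} = 5 := by
    intro g
    have := Fintype.card_congr (Equiv.sigmaFiberEquiv g)
    rw [Fintype.card_sigma, Fintype.card_fin] at this
    rw [SignType.univ_eq, Finset.sum_insert (by decide), Finset.sum_insert (by decide),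
      Finset.sum_singleton, ← add_assoc] at this
    exact this
  have e : ∀ a : SignType, Fintype.card {k // s k = a} =
      Fintype.card {k // SignType.sign (c k) = a} := by
    have t1 := htot s
    have t2 := htot fun k => SignType.sign (c k)
    intro a
    cases a
    · change Fintype.card {k // s k = 0} = Fintype.card {k // SignType.sign (c k) = 0}
      omega
    · exact hj.trans h2.symm
    · exact hi.trans h1.symm
  let σ : Fin 5 ≃ Fin 5 := Equiv.ofFiberEquiv (f := s) (g := fun k => SignType.sign (c k))
    fun a => Fintype.equivOfCardEq (e a)
  exact ⟨p ∘ σ, c ∘ σ, hp.comp σ.injective, hc.comp σ.injective, fun k =>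
    Equiv.ofFiberEquiv_map (g := fun k => SignType.sign (c k)) _ k⟩

/-! ### Width one for signatures (3,2), (2,2) and (2,1) -/

lemma hasWidth_one {P : Set (Fin 3 → ℝ)} {p : Fin 5 → Fin 3 → ℤ} (hp : IsListing P p)
    (hP : IsLattice3Polytope P) {f : (Fin 3 → ℝ) →ᵃ[ℝ] ℝ} (hf : IsIntegerFunctional f)
    (h01 : ∀ k, f (toReal3 (p k)) = 0 ∨ f (toReal3 (p k)) = 1)
    (h0 : ∃ k, f (toReal3 (p k)) = 0) (h1 : ∃ k, f (toReal3 (p k)) = 1) : HasWidth P 1 := by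
  have hull := hp.eq_convexHull hP
  obtain ⟨k0, hk0⟩ := h0
  obtain ⟨k1, hk1⟩ := h1
  refine ⟨⟨f, hf, ⟨toReal3 (p k0), toReal3 (p k1), by rw [hk0, hk1]; exact zero_ne_one⟩, 1, 0,
    ⟨⟨_, hp.mem k1, hk1⟩, ?_⟩, ⟨⟨_, hp.mem k0, hk0⟩, ?_⟩, by norm_num⟩, ?_⟩
  · rintro _ ⟨x, hx, rfl⟩
    have hsub : P ⊆ f ⁻¹' Set.Iic 1 := by
      conv_lhs => rw [hull]
      refine convexHull_min ?_ ((convex_Iic 1).affine_preimage f)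
      rintro _ ⟨k, rfl⟩
      rcases h01 k with h | h <;> simp [h]
    exact hsub hx
  · rintro _ ⟨x, hx, rfl⟩
    have hsub : P ⊆ f ⁻¹' Set.Ici 0 := by
      conv_lhs => rw [hull]
      refine convexHull_min ?_ ((convex_Ici 0).affine_preimage f)
      rintro _ ⟨k, rfl⟩
      rcases h01 k with h | h <;> simp [h]
    exact hsub hx
  · rintro u ⟨g, hg, ⟨x, y, hxy⟩, M, m, ⟨-, hM⟩, ⟨-, hm⟩, rfl⟩
    choose n hn using hg
    -- The five points affinely span the space, so a nonconstant integral functional takes two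
    -- distinct integers on them.
    have hne : ∃ k, n (p k) ≠ n (p 0) := by
      by_contra hcon
      push Not at hcon
      have hconst : ∀ z, g z = n (p 0) := by
        have : affineSpan ℝ (Set.range fun k => toReal3 (p k)) ≤
            (AffineSubspace.mk' ((n (p 0) : ℤ) : ℝ) ⊥).comap g := by
          refine affineSpan_le.2 ?_
          rintro _ ⟨k, rfl⟩
          rw [SetLike.mem_coe, AffineSubspace.mem_comap, AffineSubspace.mem_mk', hn, hcon]
          simp
        rw [hp.affineSpan_eq_top hP] at this
        intro z
        have hz := this (AffineSubspace.mem_top ℝ _ z)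
        rw [AffineSubspace.mem_comap, AffineSubspace.mem_mk'] at hz
        simpa [sub_eq_zero] using hz
      exact hxy (by rw [hconst, hconst])
    obtain ⟨k, hk⟩ := hne
    have b1 := hM ⟨_, hp.mem k, hn (p k)⟩
    have b2 := hm ⟨_, hp.mem k, hn (p k)⟩
    have b3 := hM ⟨_, hp.mem 0, hn (p 0)⟩
    have b4 := hm ⟨_, hp.mem 0, hn (p 0)⟩
    rcases lt_or_gt_of_ne hk with hlt | hlt
    · have : (n (p k) : ℝ) + 1 ≤ n (p 0) := by exact_mod_cast hlt
      linarith
    · have : (n (p 0) : ℝ) + 1 ≤ n (p k) := by exact_mod_cast hlt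
      linarith

section Width

variable {P : Set (Fin 3 → ℝ)} {p : Fin 5 → Fin 3 → ℤ} {c : Fin 5 → ℝ}
  {b : AffineBasis (Fin 4) ℝ (Fin 3 → ℝ)}

lemma IsListing.exists_isEmptyBasis (hp : IsListing P p) (hP : IsLattice3Polytope P)
    (hc : IsAffineDependence p c) {l : Fin 5} (hl0 : l ≠ 0) (hl : 0 < c l * c 0) :
    ∃ b, IsEmptyBasis b fun j => p j.succ := by
  have := (hp.isEmptyTetrahedron_iff hP hc 0).2 ⟨l, hl0, hl⟩
  simp only [Fin.zero_succAbove] at this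
  exact _root_.exists_isEmptyBasis this

lemma IsEmptyBasis.coord_add_coord_succ (hb : IsEmptyBasis b fun j => p j.succ) (i j k : Fin 4) :
    (b.coord i + b.coord j) (toReal3 (p k.succ)) =
      (if i = k then 1 else 0) + if j = k then 1 else 0 := by
  change b.coord i _ + b.coord j _ = _
  rw [hb.coord_vertex i k, hb.coord_vertex j k]

lemma IsEmptyBasis.coord_add_coord_zero (hb : IsEmptyBasis b fun j => p j.succ)
    (hc : IsAffineDependence p c) (i j : Fin 4) :
    c 0 * (b.coord i + b.coord j) (toReal3 (p 0)) = -(c i.succ + c j.succ) := by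
  have := sum_mul_affineMap hc.2.1 hc.2.2 (b.coord i + b.coord j)
  rw [Fin.sum_univ_succ] at this
  simp only [hb.coord_add_coord_succ, mul_add, Finset.sum_add_distrib, mul_ite, mul_one, mul_zero,
    Finset.sum_ite_eq, Finset.mem_univ, if_true] at this
  linarith

/-- The two inequalities put the value at `p 0`, an integer, strictly between -1 and 2. Index `i` of
the basis belongs to the point `p i.succ`. -/
lemma IsListing.hasWidth_one_of_coord (hp : IsListing P p) (hP : IsLattice3Polytope P)
    (hc : IsAffineDependence p c) (hb : IsEmptyBasis b fun j => p j.succ) {i j : Fin 4}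
    (hij : i ≠ j) (hf : IsIntegerFunctional (b.coord i + b.coord j)) (h0 : 0 < c 0)
    (h1 : c i.succ + c j.succ < c 0) (h2 : -(c i.succ + c j.succ) < 2 * c 0) :
    HasWidth P 1 := by
  refine hasWidth_one hp hP hf (fun k => ?_) ?_ ⟨i.succ, ?_⟩
  · refine Fin.cases ?_ (fun k => ?_) k
    · obtain ⟨n, hn⟩ := hf (p 0)
      have e := hb.coord_add_coord_zero hc i j
      rw [hn] at e ⊢
      have n1 : (-1 : ℝ) < n := lt_of_mul_lt_mul_left (by linarith) h0.le
      have n2 : (n : ℝ) < 2 := lt_of_mul_lt_mul_left (by linarith) h0.le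
      have n1' : -1 < n := by exact_mod_cast n1
      have n2' : n < 2 := by exact_mod_cast n2
      rcases (show n = 0 ∨ n = 1 by omega) with rfl | rfl <;> simp
    · rw [hb.coord_add_coord_succ]
      by_cases hik : i = k
      · subst hik
        simp [hij.symm]
      · by_cases hjk : j = k <;> simp [hik, hjk]
  · obtain ⟨k, hk⟩ : ∃ k : Fin 4, i ≠ k ∧ j ≠ k :=
      (by decide : ∀ i j : Fin 4, ∃ k : Fin 4, i ≠ k ∧ j ≠ k) i j
    exact ⟨k.succ, by rw [hb.coord_add_coord_succ]; simp [hk.1, hk.2]⟩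
  · rw [hb.coord_add_coord_succ]
    simp [hij.symm]

lemma IsEmptyBasis.affineMap_apply (hb : IsEmptyBasis b fun j => p j.succ)
    (f : (Fin 3 → ℝ) →ᵃ[ℝ] ℝ) (x : Fin 3 → ℝ) :
    f x = b.coord 0 x * f (toReal3 (p 1)) + b.coord 1 x * f (toReal3 (p 2)) +
      b.coord 2 x * f (toReal3 (p 3)) + b.coord 3 x * f (toReal3 (p 4)) := by
  rw [b.affineMap_eq_sum, Fin.sum_univ_four]
  simp only [hb.vertex]
  rfl

/-- The case of two positive and three negative coefficients, where the coefficient of largest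
absolute value is a positive one. -/
lemma hasWidth_one_two_three (hp : IsListing P p) (hP : IsLattice3Polytope P)
    (hc : IsAffineDependence p c) (h0 : 0 < c 0) (h1 : 0 < c 1) (h2 : c 2 < 0) (h3 : c 3 < 0)
    (h4 : c 4 < 0) (h10 : c 1 ≤ c 0) : HasWidth P 1 := by
  obtain ⟨b, hb⟩ := hp.exists_isEmptyBasis hP hc (l := 1) (by decide) (mul_pos h1 h0)
  have hsum := hc.2.1
  rw [Fin.sum_univ_five] at hsum
  rcases hb.white with hf | hf | hf
  · exact hp.hasWidth_one_of_coord hP hc hb (by decide) hf h0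
      (show c 2 + c 3 < c 0 by linarith) (show -(c 2 + c 3) < _ by linarith)
  · exact hp.hasWidth_one_of_coord hP hc hb (by decide) hf h0
      (show c 2 + c 4 < c 0 by linarith) (show -(c 2 + c 4) < _ by linarith)
  · exact hp.hasWidth_one_of_coord hP hc hb (by decide) hf h0
      (show c 3 + c 4 < c 0 by linarith) (show -(c 3 + c 4) < _ by linarith)

lemma hasWidth_one_three_two (hp : IsListing P p) (hP : IsLattice3Polytope P)
    (hc : IsAffineDependence p c) (h0 : 0 < c 0) (h1 : 0 < c 1) (h2 : 0 < c 2) (h3 : c 3 < 0)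
    (h4 : c 4 < 0) (h30 : -c 3 ≤ c 0) (h40 : -c 4 ≤ c 0) :
    HasWidth P 1 := by
  obtain ⟨b, hb⟩ := hp.exists_isEmptyBasis hP hc (l := 1) (by decide) (mul_pos h1 h0)
  have hsum := hc.2.1
  rw [Fin.sum_univ_five] at hsum
  rcases hb.white with hf | hf | hf
  · exact hp.hasWidth_one_of_coord hP hc hb (by decide) hf h0
      (show c 2 + c 3 < c 0 by linarith) (show -(c 2 + c 3) < _ by linarith)
  · exact hp.hasWidth_one_of_coord hP hc hb (by decide) hf h0
      (show c 2 + c 4 < c 0 by linarith) (show -(c 2 + c 4) < _ by linarith)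
  · by_cases hlt : -(c 3 + c 4) < 2 * c 0
    · exact hp.hasWidth_one_of_coord hP hc hb (by decide) hf h0
        (show c 3 + c 4 < c 0 by linarith) hlt
    -- Here `c 3 = c 4 = -c 0`, so `p 3` also has maximal coefficient and can be omitted instead,
    -- with signs reversed.
    · have hσ : Function.Injective (![3, 4, 0, 1, 2] : Fin 5 → Fin 5) := by decide
      exact hasWidth_one_two_three (hp.comp hσ) hP (hc.comp hσ).neg (neg_pos.2 h3) (neg_pos.2 h4)
        (neg_neg_of_pos h0) (neg_neg_of_pos h1) (neg_neg_of_pos h2)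
        (show -c 4 ≤ -c 3 by linarith)

lemma hasWidth_one_of_signature_three_two (hP : IsLattice3Polytope P) (h : HasSignature P 3 2) :
    HasWidth P 1 := by
  obtain ⟨p, c, hp, hc, hs⟩ := exists_listing_of_signature h ![1, 1, 1, -1, -1]
    (by decide) (by decide)
  have h0 : 0 < c 0 := sign_eq_one_iff.1 (hs 0)
  have h1 : 0 < c 1 := sign_eq_one_iff.1 (hs 1)
  have h2 : 0 < c 2 := sign_eq_one_iff.1 (hs 2)
  have h3 : c 3 < 0 := sign_eq_neg_one_iff.1 (hs 3)
  have h4 : c 4 < 0 := sign_eq_neg_one_iff.1 (hs 4)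
  obtain ⟨k, hk⟩ := Finite.exists_max fun k => |c k|
  have m0 := hk 0
  have m1 := hk 1
  have m2 := hk 2
  have m3 := hk 3
  have m4 := hk 4
  rw [abs_of_pos h0] at m0
  rw [abs_of_pos h1] at m1
  rw [abs_of_pos h2] at m2
  rw [abs_of_neg h3] at m3
  rw [abs_of_neg h4] at m4
  fin_cases k
  · simp only [Fin.zero_eta, abs_of_pos h0] at m0 m1 m2 m3 m4
    exact hasWidth_one_three_two hp hP hc h0 h1 h2 h3 h4 m3 m4
  · simp only [Fin.mk_one, abs_of_pos h1] at m0 m1 m2 m3 m4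
    have hσ : Function.Injective (![1, 0, 2, 3, 4] : Fin 5 → Fin 5) := by decide
    exact hasWidth_one_three_two (hp.comp hσ) hP (hc.comp hσ) h1 h0 h2 h3 h4 m3 m4
  · simp only [Fin.reduceFinMk, abs_of_pos h2] at m0 m1 m2 m3 m4
    have hσ : Function.Injective (![2, 0, 1, 3, 4] : Fin 5 → Fin 5) := by decide
    exact hasWidth_one_three_two (hp.comp hσ) hP (hc.comp hσ) h2 h0 h1 h3 h4 m3 m4
  · simp only [Fin.reduceFinMk, abs_of_neg h3] at m0 m1 m2 m3 m4
    have hσ : Function.Injective (![3, 4, 0, 1, 2] : Fin 5 → Fin 5) := by decide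
    exact hasWidth_one_two_three (hp.comp hσ) hP (hc.comp hσ).neg (neg_pos.2 h3) (neg_pos.2 h4)
        (neg_neg_of_pos h0) (neg_neg_of_pos h1) (neg_neg_of_pos h2) m4
  · simp only [Fin.reduceFinMk, abs_of_neg h4] at m0 m1 m2 m3 m4
    have hσ : Function.Injective (![4, 3, 0, 1, 2] : Fin 5 → Fin 5) := by decide
    exact hasWidth_one_two_three (hp.comp hσ) hP (hc.comp hσ).neg (neg_pos.2 h4) (neg_pos.2 h3)
        (neg_neg_of_pos h0) (neg_neg_of_pos h1) (neg_neg_of_pos h2) m3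

lemma hasWidth_one_two_two (hp : IsListing P p) (hP : IsLattice3Polytope P)
    (hc : IsAffineDependence p c) (h0 : 0 < c 0) (h1 : 0 < c 1) (h2 : c 2 < 0) (h3 : c 3 < 0)
    (h4 : c 4 = 0) (h10 : c 1 ≤ c 0) (h20 : -c 2 ≤ c 0) (h30 : -c 3 ≤ c 0) : HasWidth P 1 := by
  obtain ⟨b, hb⟩ := hp.exists_isEmptyBasis hP hc (l := 1) (by decide) (mul_pos h1 h0)
  have hsum := hc.2.1
  rw [Fin.sum_univ_five] at hsum
  have key13 : IsIntegerFunctional (b.coord 1 + b.coord 3) → HasWidth P 1 := fun hf =>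
    hp.hasWidth_one_of_coord hP hc hb (by decide) hf h0
      (show c 2 + c 4 < c 0 by linarith) (show -(c 2 + c 4) < _ by linarith)
  rcases hb.white with hf | hf | hf
  · by_cases hlt : -(c 2 + c 3) < 2 * c 0
    · exact hp.hasWidth_one_of_coord hP hc hb (by decide) hf h0
        (show c 2 + c 3 < c 0 by linarith) hlt
    -- All four nonzero coefficients tie: `p 0, p 2, p 1, p 3` form a parallelogram. The point `p 1`
    -- is omitted instead of `p 0`.
    · have e1 : c 1 = c 0 := by linarith
      have e2 : c 2 = -c 0 := by linarith
      have e3 : c 3 = -c 0 := by linarith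
      have hσ : Function.Injective (![1, 0, 2, 3, 4] : Fin 5 → Fin 5) := by decide
      have hp' := hp.comp hσ
      have hc' := hc.comp hσ
      obtain ⟨b', hb'⟩ := hp'.exists_isEmptyBasis hP hc' (l := 1) (by decide) (mul_pos h0 h1)
      rcases hb'.white with hf' | hf' | hf'
      · have v1 : (b'.coord 1 + b'.coord 2) (toReal3 (p 1)) = 2 := by
          have : c 1 * (b'.coord 1 + b'.coord 2) (toReal3 (p 1)) = -(c 2 + c 3) :=
            hb'.coord_add_coord_zero hc' 1 2
          refine mul_left_cancel₀ h1.ne' ?_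
          linarith
        have v2 : (b'.coord 1 + b'.coord 2) (toReal3 (p 2)) = 1 := by
          have := hb'.coord_add_coord_succ 1 2 1
          simpa using this
        have v3 : (b'.coord 1 + b'.coord 2) (toReal3 (p 3)) = 1 := by
          have := hb'.coord_add_coord_succ 1 2 2
          simpa using this
        have v4 : (b'.coord 1 + b'.coord 2) (toReal3 (p 4)) = 0 := by
          have := hb'.coord_add_coord_succ 1 2 3
          simpa using this
        -- Both tetrahedra offer only the bad splitting. The two functionals add up to `2 - 2 *
        -- b.coord 3`, so `b.coord 3` is half-integral and the good pair `{1, 3}` becomes available.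
        have h2int : ∀ z, ∃ m : ℤ, 2 * b.coord 3 (toReal3 z) = m := by
          intro z
          obtain ⟨m, hm⟩ := hf z
          obtain ⟨m', hm'⟩ := hf' z
          rw [hb.affineMap_apply, v1, v2, v3, v4] at hm'
          have hs := b.sum_coord_apply_eq_one (toReal3 z)
          rw [Fin.sum_univ_four] at hs
          change b.coord 1 (toReal3 z) + b.coord 2 (toReal3 z) = m at hm
          exact ⟨2 - m - m', by push_cast; linarith⟩
        refine key13 ?_
        rw [add_comm]
        exact hb.isIntegerFunctional_add_of_two_mul h2int 1
      · exact hp'.hasWidth_one_of_coord hP hc' hb' (by decide) hf' h1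
          (show c 2 + c 4 < c 1 by linarith) (show -(c 2 + c 4) < 2 * c 1 by linarith)
      · exact hp'.hasWidth_one_of_coord hP hc' hb' (by decide) hf' h1
          (show c 3 + c 4 < c 1 by linarith) (show -(c 3 + c 4) < 2 * c 1 by linarith)
  · exact key13 hf
  · exact hp.hasWidth_one_of_coord hP hc hb (by decide) hf h0
      (show c 3 + c 4 < c 0 by linarith) (show -(c 3 + c 4) < _ by linarith)

lemma hasWidth_one_of_signature_two_two (hP : IsLattice3Polytope P) (h : HasSignature P 2 2) :
    HasWidth P 1 := by
  obtain ⟨p, c, hp, hc, hs⟩ := exists_listing_of_signature h ![1, 1, -1, -1, 0]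
    (by decide) (by decide)
  have h0 : 0 < c 0 := sign_eq_one_iff.1 (hs 0)
  have h1 : 0 < c 1 := sign_eq_one_iff.1 (hs 1)
  have h2 : c 2 < 0 := sign_eq_neg_one_iff.1 (hs 2)
  have h3 : c 3 < 0 := sign_eq_neg_one_iff.1 (hs 3)
  have h4 : c 4 = 0 := sign_eq_zero_iff.1 (hs 4)
  obtain ⟨k, hk⟩ := Finite.exists_max fun k => |c k|
  have m0 := hk 0
  have m1 := hk 1
  have m2 := hk 2
  have m3 := hk 3
  rw [abs_of_pos h0] at m0
  rw [abs_of_pos h1] at m1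
  rw [abs_of_neg h2] at m2
  rw [abs_of_neg h3] at m3
  have h4' : -c 4 = 0 := by rw [h4, neg_zero]
  fin_cases k
  · simp only [Fin.zero_eta, abs_of_pos h0] at m0 m1 m2 m3
    exact hasWidth_one_two_two hp hP hc h0 h1 h2 h3 h4 m1 m2 m3
  · simp only [Fin.mk_one, abs_of_pos h1] at m0 m1 m2 m3
    have hσ : Function.Injective (![1, 0, 2, 3, 4] : Fin 5 → Fin 5) := by decide
    exact hasWidth_one_two_two (hp.comp hσ) hP (hc.comp hσ) h1 h0 h2 h3 h4 m0 m2 m3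
  · simp only [Fin.reduceFinMk, abs_of_neg h2] at m0 m1 m2 m3
    have hσ : Function.Injective (![2, 3, 0, 1, 4] : Fin 5 → Fin 5) := by decide
    exact hasWidth_one_two_two (hp.comp hσ) hP (hc.comp hσ).neg (neg_pos.2 h2) (neg_pos.2 h3)
      (neg_neg_of_pos h0) (neg_neg_of_pos h1) h4' m3
      (show - -c 0 ≤ -c 2 by linarith) (show - -c 1 ≤ -c 2 by linarith)
  · simp only [Fin.reduceFinMk, abs_of_neg h3] at m0 m1 m2 m3
    have hσ : Function.Injective (![3, 2, 0, 1, 4] : Fin 5 → Fin 5) := by decide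
    exact hasWidth_one_two_two (hp.comp hσ) hP (hc.comp hσ).neg (neg_pos.2 h3) (neg_pos.2 h2)
      (neg_neg_of_pos h0) (neg_neg_of_pos h1) h4' m2
      (show - -c 0 ≤ -c 3 by linarith) (show - -c 1 ≤ -c 3 by linarith)
  · exfalso
    simp only [Fin.reduceFinMk, h4, abs_zero] at m0
    linarith

/-- The point `p 1` lies between `p 0` and `p 2`, and the pair `{p 3, p 4}` always works. Other
pairs can fail only if `p 1` is the midpoint; then the tetrahedra omitting `p 0` and `p 2` are
compared. -/
lemma hasWidth_one_two_one (hp : IsListing P p) (hP : IsLattice3Polytope P)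
    (hc : IsAffineDependence p c) (h0 : 0 < c 0) (h2 : 0 < c 2) (h3 : c 3 = 0)
    (h4 : c 4 = 0) (h20 : c 2 ≤ c 0) : HasWidth P 1 := by
  obtain ⟨b, hb⟩ := hp.exists_isEmptyBasis hP hc (l := 2) (by decide) (mul_pos h2 h0)
  have key23 : IsIntegerFunctional (b.coord 2 + b.coord 3) → HasWidth P 1 := fun hf =>
    hp.hasWidth_one_of_coord hP hc hb (by decide) hf h0
      (show c 3 + c 4 < c 0 by linarith) (show -(c 3 + c 4) < _ by linarith)
  rcases h20.lt_or_eq with hlt | heq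
  · rcases hb.white with hf | hf | hf
    · exact hp.hasWidth_one_of_coord hP hc hb (by decide) hf h0
        (show c 2 + c 3 < c 0 by linarith) (show -(c 2 + c 3) < _ by linarith)
    · exact hp.hasWidth_one_of_coord hP hc hb (by decide) hf h0
        (show c 2 + c 4 < c 0 by linarith) (show -(c 2 + c 4) < _ by linarith)
    · exact key23 hf
  have hσ : Function.Injective (![2, 1, 0, 3, 4] : Fin 5 → Fin 5) := by decide
  have hp' := hp.comp hσ
  have hc' := hc.comp hσ
  obtain ⟨b', hb'⟩ := hp'.exists_isEmptyBasis hP hc' (l := 2) (by decide) (mul_pos h0 h2)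
  -- In the coordinates of `b`, a functional from the second tetrahedron on the pair `{1, i}` is
  -- `b.coord i - b.coord 1`.
  have hval : ∀ i : Fin 4, i ≠ 1 → c i.succ = 0 → i ≠ 0 →
      IsIntegerFunctional (b'.coord 1 + b'.coord i) →
      ∀ z, ∃ m : ℤ, b.coord i (toReal3 z) - b.coord 1 (toReal3 z) = m := by
    intro i hi1 hci hi0 hf' z
    obtain ⟨m, hm⟩ := hf' z
    refine ⟨m, ?_⟩
    have v2 : (b'.coord 1 + b'.coord i) (toReal3 (p 2)) = -1 := by
      have e : c 2 * (b'.coord 1 + b'.coord i) (toReal3 (p 2)) =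
          -((c ∘ ![2, 1, 0, 3, 4]) (Fin.succ 1) + (c ∘ ![2, 1, 0, 3, 4]) i.succ) :=
        hb'.coord_add_coord_zero hc' 1 i
      have e' : (c ∘ ![2, 1, 0, 3, 4]) i.succ = 0 := by
        fin_cases i
        · exact absurd rfl hi0
        · exact absurd rfl hi1
        · exact h3
        · exact h4
      have e'' : (c ∘ ![2, 1, 0, 3, 4]) (Fin.succ 1) = c 0 := rfl
      rw [e', e''] at e
      refine mul_left_cancel₀ h2.ne' ?_
      linarith
    have v1 : (b'.coord 1 + b'.coord i) (toReal3 (p 1)) = 0 := by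
      have := hb'.coord_add_coord_succ 1 i 0
      simpa [hi0] using this
    have v3 : (b'.coord 1 + b'.coord i) (toReal3 (p 3)) = if i = 2 then 1 else 0 := by
      have := hb'.coord_add_coord_succ 1 i 2
      simpa using this
    have v4 : (b'.coord 1 + b'.coord i) (toReal3 (p 4)) = if i = 3 then 1 else 0 := by
      have := hb'.coord_add_coord_succ 1 i 3
      simpa using this
    rw [hb.affineMap_apply, v1, v2, v3, v4] at hm
    fin_cases i
    · exact absurd rfl hi0
    · exact absurd rfl hi1
    · simp at hm
      simp
      linarith
    · simp at hm
      simp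
      linarith
  have hadd : ∀ {i j : Fin 4}, IsIntegerFunctional (b.coord 1 + b.coord i) →
      (∀ z, ∃ m : ℤ, b.coord j (toReal3 z) - b.coord 1 (toReal3 z) = m) →
      ∀ z, ∃ m : ℤ, b.coord i (toReal3 z) + b.coord j (toReal3 z) = m := by
    intro i j h1 h2 z
    obtain ⟨m, hm⟩ := h1 z
    obtain ⟨l, hl⟩ := h2 z
    change b.coord 1 (toReal3 z) + b.coord i (toReal3 z) = m at hm
    exact ⟨m + l, by push_cast; linarith⟩
  have hkey' : IsIntegerFunctional (b'.coord 2 + b'.coord 3) → HasWidth P 1 := fun hf =>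
    hp'.hasWidth_one_of_coord hP hc' hb' (by decide) hf h2
      (show c 3 + c 4 < c 2 by linarith) (show -(c 3 + c 4) < 2 * c 2 by linarith)
  rcases hb'.white with hf' | hf' | hf'
  · have hv := hval 2 (by decide) h3 (by decide) hf'
    rcases hb.white with hf | hf | hf
    -- Both tetrahedra pair the line with the same point, so adding the functionals makes `2 *
    -- b.coord 2` integral.
    · refine key23 (hb.isIntegerFunctional_add_of_two_mul (i := 2) (fun z => ?_) 3)
      rw [two_mul]
      exact hadd hf hv z
    · refine key23 ?_
      rw [add_comm]
      exact hadd hf hv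
    · exact key23 hf
  · have hv := hval 3 (by decide) h4 (by decide) hf'
    rcases hb.white with hf | hf | hf
    · exact key23 (hadd hf hv)
    · refine key23 ?_
      rw [add_comm]
      refine hb.isIntegerFunctional_add_of_two_mul (i := 3) (fun z => ?_) 2
      rw [two_mul]
      exact hadd hf hv z
    · exact key23 hf
  · exact hkey' hf'

lemma hasWidth_one_of_signature_two_one (hP : IsLattice3Polytope P) (h : HasSignature P 2 1) :
    HasWidth P 1 := by
  obtain ⟨p, c, hp, hc, hs⟩ := exists_listing_of_signature h ![1, -1, 1, 0, 0]
    (by decide) (by decide)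
  have h0 : 0 < c 0 := sign_eq_one_iff.1 (hs 0)
  have h2 : 0 < c 2 := sign_eq_one_iff.1 (hs 2)
  have h3 : c 3 = 0 := sign_eq_zero_iff.1 (hs 3)
  have h4 : c 4 = 0 := sign_eq_zero_iff.1 (hs 4)
  rcases le_total (c 2) (c 0) with hle | hle
  · exact hasWidth_one_two_one hp hP hc h0 h2 h3 h4 hle
  · have hσ : Function.Injective (![2, 1, 0, 3, 4] : Fin 5 → Fin 5) := by decide
    exact hasWidth_one_two_one (hp.comp hσ) hP (hc.comp hσ) h2 h0 h3 h4 hle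

end Width

/-! ### Determinants and volume vectors -/

section Volume

lemma homogeneousDet_comp_perm (t : Fin 4 → Fin 3 → ℤ) (σ : Equiv.Perm (Fin 4)) :
    homogeneousDet (t ∘ σ) = Equiv.Perm.sign σ * homogeneousDet t :=
  Matrix.det_permute' σ (homogeneousMatrix t)

lemma exists_perm_of_range_eq {s t : Fin 4 → Fin 3 → ℤ} (hs : Function.Injective s)
    (h : Set.range s = Set.range t) : ∃ σ : Equiv.Perm (Fin 4), s = t ∘ σ := by
  choose τ hτ using fun j => (h ▸ Set.mem_range_self j : s j ∈ Set.range t)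
  have hinj : Function.Injective τ := fun i j hij => hs (by rw [← hτ, ← hτ, hij])
  exact ⟨Equiv.ofBijective τ (Finite.injective_iff_bijective.1 hinj), funext fun j => (hτ j).symm⟩

lemma tetrahedronVolume_eq_of_range_eq {s t : Fin 4 → Fin 3 → ℤ} (hs : Function.Injective s)
    (h : Set.range s = Set.range t) : tetrahedronVolume s = tetrahedronVolume t := by
  obtain ⟨σ, rfl⟩ := exists_perm_of_range_eq hs h
  rw [tetrahedronVolume, tetrahedronVolume, homogeneousDet_comp_perm, abs_mul]
  rcases Int.units_eq_one_or (Equiv.Perm.sign σ) with h | h <;> simp [h]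

lemma IsEmptyTetrahedron.of_range_eq {s t : Fin 4 → Fin 3 → ℤ} (ht : IsEmptyTetrahedron t)
    (hs : Function.Injective s) (h : Set.range s = Set.range t) : IsEmptyTetrahedron s := by
  obtain ⟨σ, rfl⟩ := exists_perm_of_range_eq hs h
  refine ⟨ht.1.comp_embedding σ.toEmbedding, ?_⟩
  have : tetrahedron (t ∘ σ) = tetrahedron t :=
    congrArg (convexHull ℝ) (σ.surjective.range_comp fun j => toReal3 (t j))
  rw [h, this, ht.2]

lemma sum_mul_volumeVector (p : Fin 5 → Fin 3 → ℤ) (i : Fin 4) :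
    ∑ k, (Fin.cons 1 (p k) : Fin 4 → ℤ) i * volumeVector p k = 0 := by
  -- Repeat row `i` of the homogeneous coordinates on top; expanding the vanishing determinant along
  -- that row gives the relation.
  have h := Matrix.det_zero_of_row_eq (M := Matrix.of fun a k : Fin 5 =>
    (Fin.cons ((Fin.cons 1 (p k) : Fin 4 → ℤ) i) (Fin.cons 1 (p k) : Fin 4 → ℤ) : Fin 5 → ℤ) a)
    (i := 0) (j := i.succ) (Fin.succ_ne_zero i).symm (by ext k; simp)
  rw [Matrix.det_succ_row_zero] at h
  rw [← h]
  refine Finset.sum_congr rfl fun k _ => ?_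
  rw [volumeVector, Matrix.of_apply, Fin.cons_zero, ← mul_assoc, mul_comm _ ((-1 : ℤ) ^ (k : ℕ))]
  rfl

lemma sum_volumeVector (p : Fin 5 → Fin 3 → ℤ) : ∑ k, (volumeVector p k : ℝ) = 0 := by
  have := sum_mul_volumeVector p 0
  simp only [Fin.cons_zero, one_mul] at this
  exact_mod_cast this

lemma sum_volumeVector_smul (p : Fin 5 → Fin 3 → ℤ) :
    ∑ k, (volumeVector p k : ℝ) • toReal3 (p k) = 0 := by
  ext i
  have := sum_mul_volumeVector p i.succ
  simp only [Fin.cons_succ] at this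
  simp only [Finset.sum_apply, Pi.smul_apply, toReal3_apply, smul_eq_mul, Pi.zero_apply]
  simp_rw [mul_comm]
  exact_mod_cast this

lemma tetrahedronVolume_succAbove (p : Fin 5 → Fin 3 → ℤ) (k : Fin 5) :
    tetrahedronVolume (fun j => p (k.succAbove j)) = |volumeVector p k| := by
  rw [tetrahedronVolume, volumeVector, abs_mul, abs_pow, abs_neg, abs_one, one_pow, one_mul]

end Volume

/-! ### Empty tetrahedra when one coefficient is negative -/

section Listing

variable {P : Set (Fin 3 → ℝ)} {p : Fin 5 → Fin 3 → ℤ} {c : Fin 5 → ℝ}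

lemma IsListing.exists_volumeVector_eq (hp : IsListing P p) (hP : IsLattice3Polytope P)
    (hc : IsAffineDependence p c) : ∃ r : ℝ, r ≠ 0 ∧ ∀ k, (volumeVector p k : ℝ) = r * c k := by
  obtain ⟨k, hk⟩ := Function.ne_iff.1 hc.1
  refine ⟨volumeVector p k / c k, div_ne_zero ?_ hk, fun i =>
    hp.dependence_unique hP hc hk (sum_volumeVector p) (sum_volumeVector_smul p) i⟩
  have := homogeneousDet_ne_zero (hp.affineIndependent hP hc hk)
  rw [volumeVector]
  push_cast
  exact mul_ne_zero (pow_ne_zero _ (by norm_num)) (by exact_mod_cast this)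

lemma IsListing.image_compl (hp : IsListing P p) (k : Fin 5) :
    p '' {k}ᶜ = latticePoints P \ {p k} := by
  rw [Set.compl_eq_univ_sdiff, Set.image_sdiff hp.1, Set.image_univ, hp.2, Set.image_singleton]

lemma IsListing.range_succAbove (hp : IsListing P p) (k : Fin 5) :
    (Set.range fun j => p (k.succAbove j)) = latticePoints P \ {p k} := by
  rw [← hp.image_compl, ← Fin.range_succAbove, ← Set.range_comp]
  rfl

lemma IsListing.exists_cons (hp : IsListing P p) {t : Fin 4 → Fin 3 → ℤ}
    (ht : IsEmptyTetrahedron t) (htP : tetrahedron t ⊆ P) :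
    ∃ k, IsListing P (Fin.cons (p k) t : Fin 5 → Fin 3 → ℤ) := by
  have hinj : Function.Injective t := fun i j hij => ht.1.injective (by simp only [hij])
  choose τ hτ using fun j => hp.exists_eq (htP (subset_convexHull ℝ _ ⟨j, rfl⟩) :
    toReal3 (t j) ∈ P)
  have hτi : Function.Injective τ := fun i j hij => hinj (by rw [← hτ, ← hτ, hij])
  obtain ⟨k, hk⟩ : ∃ k, k ∉ Set.range τ := by
    by_contra hcon
    push Not at hcon
    have := Fintype.card_le_of_surjective τ hcon
    simp at this
  refine ⟨k, ?_⟩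
  have hσ : Function.Injective (Fin.cons k τ : Fin 5 → Fin 5) := Fin.cons_injective_iff.2 ⟨hk, hτi⟩
  convert hp.comp hσ using 1
  ext i : 1
  refine Fin.cases ?_ (fun j => ?_) i
  · simp
  · simp [hτ]

lemma IsListing.exists_range_succAbove (hp : IsListing P p) {t : Fin 4 → Fin 3 → ℤ}
    (ht : IsEmptyTetrahedron t) (htP : tetrahedron t ⊆ P) :
    ∃ k : Fin 5, (Set.range fun j => p (k.succAbove j)) = Set.range t := by
  obtain ⟨k, hk⟩ := hp.exists_cons ht htP
  refine ⟨k, ?_⟩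
  rw [hp.range_succAbove]
  have := hk.range_succAbove 0
  simpa using this.symm

/-- The affine dependences with one negative coefficient, at `e`, and at most one zero. -/
structure IsDependenceWithNeg (p : Fin 5 → Fin 3 → ℤ) (c : Fin 5 → ℝ) (e : Fin 5) : Prop where
  dep : IsAffineDependence p c
  neg : c e < 0
  nonneg : ∀ k, k ≠ e → 0 ≤ c k
  add_pos : ∀ k l, k ≠ l → k ≠ e → l ≠ e → 0 < c k + c l

namespace IsDependenceWithNeg

variable {e : Fin 5}

lemma exists_of_signature (hp : IsListing P p) (h : HasSignature P 3 1 ∨ HasSignature P 4 1) :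
    ∃ c e, IsDependenceWithNeg p c e := by
  obtain ⟨p', c, hp', hc, h0, h1, h2, h3, h4⟩ : ∃ p' c, IsListing P p' ∧ IsAffineDependence p' c ∧
      c 0 < 0 ∧ 0 < c 1 ∧ 0 < c 2 ∧ 0 < c 3 ∧ 0 ≤ c 4 := by
    rcases h with h | h
    · obtain ⟨p, c, hp, hc, hs⟩ := exists_listing_of_signature h ![-1, 1, 1, 1, 0]
        (by decide) (by decide)
      exact ⟨p, c, hp, hc, sign_eq_neg_one_iff.1 (hs 0), sign_eq_one_iff.1 (hs 1),
        sign_eq_one_iff.1 (hs 2), sign_eq_one_iff.1 (hs 3), (sign_eq_zero_iff.1 (hs 4)).ge⟩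
    · obtain ⟨p, c, hp, hc, hs⟩ := exists_listing_of_signature h ![-1, 1, 1, 1, 1]
        (by decide) (by decide)
      exact ⟨p, c, hp, hc, sign_eq_neg_one_iff.1 (hs 0), sign_eq_one_iff.1 (hs 1),
        sign_eq_one_iff.1 (hs 2), sign_eq_one_iff.1 (hs 3), (sign_eq_one_iff.1 (hs 4)).le⟩
  obtain ⟨σ, rfl⟩ := hp'.exists_perm hp
  have hpos : ∀ k, k ≠ 0 → k ≠ 4 → 0 < c k := by
    intro k; fin_cases k <;> simp_all
  have hnn : ∀ k, k ≠ 0 → 0 ≤ c k := fun k hk => by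
    by_cases hk4 : k = 4
    · exact hk4 ▸ h4
    · exact (hpos k hk hk4).le
  have hne : ∀ k, k ≠ σ.symm 0 → σ k ≠ 0 := fun k hk h => hk (by rw [← h]; simp)
  refine ⟨c ∘ σ, σ.symm 0, hc.comp σ.injective, by simpa using h0, fun k hk => hnn _ (hne k hk),
    fun k l hkl hk hl => ?_⟩
  have hσ : σ k ≠ σ l := fun h => hkl (σ.injective h)
  by_cases hk4 : σ k = 4
  · exact add_pos_of_nonneg_of_pos (hnn _ (hne k hk))
      (hpos _ (hne l hl) fun h => hσ (hk4.trans h.symm))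
  · exact add_pos_of_pos_of_nonneg (hpos _ (hne k hk) hk4) (hnn _ (hne l hl))

lemma exists_of_signature_four_one (hp : IsListing P p) (h : HasSignature P 4 1) :
    ∃ c e, IsDependenceWithNeg p c e ∧ ∀ k, k ≠ e → 0 < c k := by
  obtain ⟨p', c, hp', hc, hs⟩ := exists_listing_of_signature h ![-1, 1, 1, 1, 1]
    (by decide) (by decide)
  obtain ⟨σ, rfl⟩ := hp'.exists_perm hp
  have hpos : ∀ k, k ≠ 0 → 0 < c k := by
    intro k hk
    refine sign_eq_one_iff.1 ((hs k).trans ?_)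
    fin_cases k <;> simp_all
  have hpos' : ∀ k, k ≠ σ.symm 0 → 0 < c (σ k) := fun k hk =>
    hpos _ fun h => hk (by rw [← h]; simp)
  exact ⟨c ∘ σ, σ.symm 0, ⟨hc.comp σ.injective, by simpa using sign_eq_neg_one_iff.1 (hs 0),
    fun k hk => (hpos' k hk).le, fun k l _ hk hl => _root_.add_pos (hpos' k hk) (hpos' l hl)⟩, hpos'⟩

lemma isEmptyTetrahedron (h : IsDependenceWithNeg p c e) (hp : IsListing P p)
    (hP : IsLattice3Polytope P) {k : Fin 5} (hk : 0 < c k) :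
    IsEmptyTetrahedron fun j => p (k.succAbove j) := by
  have hke : k ≠ e := fun h' => absurd h.neg (h' ▸ hk.not_gt)
  obtain ⟨l, m, hlm, hlk, hmk, hle, hme⟩ : ∃ l m : Fin 5, l ≠ m ∧ l ≠ k ∧ m ≠ k ∧ l ≠ e ∧ m ≠ e :=
    (by decide : ∀ k e : Fin 5, ∃ l m : Fin 5, l ≠ m ∧ l ≠ k ∧ m ≠ k ∧ l ≠ e ∧ m ≠ e) k e
  refine (hp.isEmptyTetrahedron_iff hP h.dep k).2 ?_
  have := h.add_pos l m hlm hle hme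
  rcases (h.nonneg l hle).eq_or_lt with h0 | h0
  · exact ⟨m, hmk, mul_pos (by linarith) hk⟩
  · exact ⟨l, hlk, mul_pos h0 hk⟩

lemma exists_pos (h : IsDependenceWithNeg p c e) : ∃ k, 0 < c k := by
  by_contra hcon
  push Not at hcon
  have := h.dep.2.1
  have h2 : ∑ k, c k < 0 := Finset.sum_neg' (fun k _ => hcon k) ⟨e, Finset.mem_univ e, h.neg⟩
  linarith

lemma exists_isLargest (h : IsDependenceWithNeg p c e) (hp : IsListing P p)
    (hP : IsLattice3Polytope P) : ∃ t, IsLargestEmptyTetrahedron P t := by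
  have hfin : {s | IsEmptyTetrahedron s ∧ tetrahedron s ⊆ P}.Finite := by
    refine (Set.Finite.pi' (t := fun _ : Fin 4 => latticePoints P)
      fun _ => hp.2 ▸ Set.finite_range p).subset ?_
    rintro s ⟨-, hs⟩ j
    exact hs (subset_convexHull ℝ _ ⟨j, rfl⟩)
  obtain ⟨k, hk⟩ := h.exists_pos
  obtain ⟨t, ⟨ht, htP⟩, hmax⟩ := Set.exists_max_image _ tetrahedronVolume hfin
    ⟨_, h.isEmptyTetrahedron hp hP hk, hp.tetrahedron_subset hP k⟩
  exact ⟨t, ht, htP, fun s hs hsP => hmax s ⟨hs, hsP⟩⟩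

lemma injective_succAbove (hp : IsListing P p) (k : Fin 5) :
    Function.Injective fun j => p (k.succAbove j) :=
  hp.1.comp Fin.succAbove_right_injective

/-- The omitted coefficient shares its sign with another one, and only one coefficient is negative.
-/
lemma pos_of_isEmptyTetrahedron (h : IsDependenceWithNeg p c e) (hp : IsListing P p)
    (hP : IsLattice3Polytope P) {t : Fin 4 → Fin 3 → ℤ} (ht : IsEmptyTetrahedron t) {k : Fin 5}
    (hk : (Set.range fun j => p (k.succAbove j)) = Set.range t) : 0 < c k := by
  obtain ⟨l, hlk, hl⟩ := (hp.isEmptyTetrahedron_iff hP h.dep k).1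
    (ht.of_range_eq (injective_succAbove hp k) hk)
  by_contra hneg
  have h1 : c l < 0 := neg_of_mul_pos_left hl (not_lt.1 hneg)
  have h2 : c k < 0 := neg_of_mul_pos_right hl h1.le
  have hle : l = e := by
    by_contra hle
    linarith [h.nonneg l hle]
  have hke : k = e := by
    by_contra hke
    linarith [h.nonneg k hke]
  exact hlk (hle.trans hke.symm)

/-- Volumes are proportional to the absolute values of the coefficients, and every positive
coefficient gives an empty competitor. -/
lemma le_of_isLargest (h : IsDependenceWithNeg p c e) (hp : IsListing P p)
    (hP : IsLattice3Polytope P) {t : Fin 4 → Fin 3 → ℤ} (ht : IsLargestEmptyTetrahedron P t)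
    {k : Fin 5} (hk : (Set.range fun j => p (k.succAbove j)) = Set.range t) (l : Fin 5)
    (hle : l ≠ e) : c l ≤ c k := by
  have hk0 := h.pos_of_isEmptyTetrahedron hp hP ht.1 hk
  rcases (h.nonneg l hle).eq_or_lt with h0 | h0
  · linarith
  have h1 := ht.2.2 _ (h.isEmptyTetrahedron hp hP h0) (hp.tetrahedron_subset hP l)
  rw [← tetrahedronVolume_eq_of_range_eq (injective_succAbove hp k) hk,
    tetrahedronVolume_succAbove, tetrahedronVolume_succAbove] at h1
  obtain ⟨r, hr, hv⟩ := hp.exists_volumeVector_eq hP h.dep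
  have h2 : |(volumeVector p l : ℝ)| ≤ |(volumeVector p k : ℝ)| := by exact_mod_cast h1
  rw [hv, hv, abs_mul, abs_mul, abs_of_pos h0, abs_of_pos hk0] at h2
  exact le_of_mul_le_mul_left h2 (abs_pos.2 hr)

end IsDependenceWithNeg

end Listing

/-! ### The values -1 and -2, and the symmetric volume vector -/

section Main

variable {P : Set (Fin 3 → ℝ)} {p : Fin 5 → Fin 3 → ℤ} {c : Fin 5 → ℝ} {e : Fin 5}

lemma compl_four_eq : ({4}ᶜ : Set (Fin 5)) = {0, 1, 2, 3} := by
  ext k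
  fin_cases k <;> simp

lemma IsListing.range_succ (hp : IsListing P p) :
    (Set.range fun j : Fin 4 => p j.succ) = latticePoints P \ {p 0} := by
  simpa using hp.range_succAbove 0

/-- The omitted point is `p 0` and the negative one is `p 1`, basis index 0. The three pairs in
White's theorem avoid index 0, so both coefficients in the pair are nonnegative and at most `c 0`.
-/
lemma takesValues_of_coord (hp : IsListing P p) (hP : IsLattice3Polytope P)
    (hc : IsDependenceWithNeg p c 1) (h0 : 0 < c 0) (hmax : ∀ l, l ≠ 1 → c l ≤ c 0)
    {t : Fin 4 → Fin 3 → ℤ} (ht : (Set.range fun j : Fin 4 => p j.succ) = Set.range t) :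
    ∃ f, ∃ h : ℤ, (h = -1 ∨ h = -2) ∧ TakesValues P t f h := by
  obtain ⟨l, hl0, hl⟩ : ∃ l : Fin 5, l ≠ 0 ∧ 0 < c l * c 0 := by
    have := hc.add_pos 2 3 (by decide) (by decide) (by decide)
    rcases (hc.nonneg 2 (by decide)).eq_or_lt with h2 | h2
    · exact ⟨3, by decide, mul_pos (by linarith) h0⟩
    · exact ⟨2, by decide, mul_pos h2 h0⟩
  obtain ⟨b, hb⟩ := hp.exists_isEmptyBasis hP hc.dep hl0 hl
  have key : ∀ i j l : Fin 4, i ≠ 0 → j ≠ 0 → i ≠ j → l ≠ i → l ≠ j →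
      Function.Injective ![i.succ, j.succ, 1, l.succ, 0] →
      IsIntegerFunctional (b.coord i + b.coord j) →
      ∃ f, ∃ h : ℤ, (h = -1 ∨ h = -2) ∧ TakesValues P t f h := by
    intro i j l hi hj hij hli hlj hσ hf
    have hi1 : i.succ ≠ 1 := fun h => hi (Fin.succ_injective _ h)
    have hj1 : j.succ ≠ 1 := fun h => hj (Fin.succ_injective _ h)
    obtain ⟨n, hn⟩ := hf (p 0)
    have hv := hb.coord_add_coord_zero hc.dep i j
    have hpos := hc.add_pos i.succ j.succ (fun h => hij (Fin.succ_injective _ h)) hi1 hj1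
    have hmi := hmax i.succ hi1
    have hmj := hmax j.succ hj1
    have hn12 : n = -1 ∨ n = -2 := by
      rw [hn] at hv
      have n1 : (n : ℝ) < 0 := lt_of_mul_lt_mul_left (by linarith) h0.le
      have n2 : (-2 : ℝ) ≤ n := le_of_mul_le_mul_left (by linarith) h0
      have n1' : n < 0 := by exact_mod_cast n1
      have n2' : -2 ≤ n := by exact_mod_cast n2
      omega
    have hp' := hp.comp hσ
    refine ⟨_, n, hn12, hf, _, hp', ?_, ?_, ?_, ?_, ?_, hn⟩
    · rw [← compl_four_eq, hp'.image_compl, ← ht, hp.range_succ]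
      rfl
    · change (b.coord i + b.coord j) (toReal3 (p i.succ)) = 1
      rw [hb.coord_add_coord_succ]
      simp [hij.symm]
    · change (b.coord i + b.coord j) (toReal3 (p j.succ)) = 1
      rw [hb.coord_add_coord_succ]
      simp [hij]
    · change (b.coord i + b.coord j) (toReal3 (p (Fin.succ 0))) = 0
      rw [hb.coord_add_coord_succ]
      simp [hi, hj]
    · change (b.coord i + b.coord j) (toReal3 (p l.succ)) = 0
      rw [hb.coord_add_coord_succ]
      simp [hli.symm, hlj.symm]
  rcases hb.white with hf | hf | hf
  · exact key 1 2 3 (by decide) (by decide) (by decide) (by decide) (by decide) (by decide) hf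
  · exact key 1 3 2 (by decide) (by decide) (by decide) (by decide) (by decide) (by decide) hf
  · exact key 2 3 1 (by decide) (by decide) (by decide) (by decide) (by decide) (by decide) hf

lemma IsDependenceWithNeg.comp_perm (h : IsDependenceWithNeg p c e) (σ : Equiv.Perm (Fin 5)) :
    IsDependenceWithNeg (p ∘ σ) (c ∘ σ) (σ.symm e) := by
  have hne : ∀ {k}, k ≠ σ.symm e → σ k ≠ e := fun hk h => hk (by rw [← h]; simp)
  exact ⟨h.dep.comp σ.injective, by simpa using h.neg, fun k hk => h.nonneg _ (hne hk),
    fun k l hkl hk hl => h.add_pos _ _ (σ.injective.ne hkl) (hne hk) (hne hl)⟩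

lemma exists_takesValues (hp : IsListing P p) (hP : IsLattice3Polytope P)
    (hc : IsDependenceWithNeg p c e) {t : Fin 4 → Fin 3 → ℤ}
    (ht : IsLargestEmptyTetrahedron P t) :
    ∃ f, ∃ h : ℤ, (h = -1 ∨ h = -2) ∧ TakesValues P t f h := by
  obtain ⟨k, hk⟩ := hp.exists_range_succAbove ht.1 ht.2.1
  have hk0 := hc.pos_of_isEmptyTetrahedron hp hP ht.1 hk
  have hke : k ≠ e := fun h' => absurd hc.neg (h' ▸ hk0.not_gt)
  obtain ⟨σ, hσ0, hσ1⟩ : ∃ σ : Equiv.Perm (Fin 5), σ 0 = k ∧ σ 1 = e := by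
    have he : Equiv.swap 0 k e ≠ 0 := fun h => by
      have := congrArg (Equiv.swap 0 k) h
      rw [Equiv.swap_apply_self, Equiv.swap_apply_left] at this
      exact hke this.symm
    refine ⟨(Equiv.swap 1 (Equiv.swap 0 k e)).trans (Equiv.swap 0 k), ?_, ?_⟩
    · rw [Equiv.trans_apply, Equiv.swap_apply_of_ne_of_ne (by decide) he.symm,
        Equiv.swap_apply_left]
    · rw [Equiv.trans_apply, Equiv.swap_apply_left, Equiv.swap_apply_self]
  have hp' := hp.comp σ.injective
  have hc' := hc.comp_perm σ
  rw [← hσ1, Equiv.symm_apply_apply] at hc'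
  refine takesValues_of_coord hp' hP hc' (by simpa [hσ0] using hk0) (fun l hl => ?_) ?_
  · have := hc.le_of_isLargest hp hP ht hk (σ l) fun h => hl (σ.injective (h.trans hσ1.symm))
    simpa [hσ0] using this
  · rw [hp'.range_succ, ← hk, hp.range_succAbove, Function.comp_apply, hσ0]

lemma TakesValues.sum_eq {f : (Fin 3 → ℝ) →ᵃ[ℝ] ℝ} {h : ℤ} (hc : IsAffineDependence p c)
    (h0 : f (toReal3 (p 0)) = 1) (h1 : f (toReal3 (p 1)) = 1) (h2 : f (toReal3 (p 2)) = 0)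
    (h3 : f (toReal3 (p 3)) = 0) (h4 : f (toReal3 (p 4)) = h) : c 0 + c 1 + h * c 4 = 0 := by
  have := sum_mul_affineMap hc.2.1 hc.2.2 f
  rw [Fin.sum_univ_five, h0, h1, h2, h3, h4] at this
  linarith

/-- Since the coefficients sum to zero, `c 2 + c 3 = (h - 1) * c 4` is negative. -/
lemma neg_index_eq (hc : IsDependenceWithNeg p c e) (h4 : 0 < c 4) {h : ℤ}
    (hh : h = -1 ∨ h = -2) (hs : c 0 + c 1 + h * c 4 = 0) : e = 2 ∨ e = 3 := by
  have hsum := hc.dep.2.1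
  rw [Fin.sum_univ_five] at hsum
  have hh' : (h : ℝ) * c 4 < 0 := by
    rcases hh with rfl | rfl <;> push_cast <;> linarith
  have hneg := hc.neg
  have hnn := hc.nonneg
  fin_cases e
  · have := hnn 2 (by decide)
    have := hnn 3 (by decide)
    linarith
  · have := hnn 2 (by decide)
    have := hnn 3 (by decide)
    linarith
  · exact Or.inl rfl
  · exact Or.inr rfl
  · exact absurd hneg h4.not_gt

lemma volumeVector_comp_swap (p : Fin 5 → Fin 3 → ℤ) :
    volumeVector (p ∘ Equiv.swap 0 1) 4 = -volumeVector p 4 := by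
  have e : (fun j : Fin 4 => (p ∘ Equiv.swap 0 1) (Fin.succAbove 4 j)) =
      (fun j => p (Fin.succAbove 4 j)) ∘ Equiv.swap (0 : Fin 4) 1 := by
    funext j
    fin_cases j <;> rfl
  rw [volumeVector, volumeVector, e, homogeneousDet_comp_perm, Equiv.Perm.sign_swap (by decide)]
  simp

lemma volumeVector_eq_of_dependence (hp : IsListing P p) (hP : IsLattice3Polytope P)
    (hc : IsAffineDependence p c) {a : ℝ} (h0 : c 0 = a) (h1 : c 1 = a) (h2 : c 2 = a)
    (h3 : c 3 = a) (h4 : c 4 = -4 * a) :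
    ∃ q : ℤ, q ≠ 0 ∧ volumeVector p = ![q, q, q, q, -4 * q] := by
  obtain ⟨r, hr, hv⟩ := hp.exists_volumeVector_eq hP hc
  have ha : a ≠ 0 := by
    rintro rfl
    exact hc.1 (funext fun k => by fin_cases k <;> simp [h0, h1, h2, h3, h4])
  refine ⟨volumeVector p 0, ?_, ?_⟩
  · have : (volumeVector p 0 : ℝ) ≠ 0 := by rw [hv, h0]; exact mul_ne_zero hr ha
    exact_mod_cast this
  · have key : ∀ k, c k = a → volumeVector p k = volumeVector p 0 := fun k hk => by
      have : (volumeVector p k : ℝ) = volumeVector p 0 := by rw [hv, hv, hk, h0]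
      exact_mod_cast this
    have h4' : volumeVector p 4 = -4 * volumeVector p 0 := by
      have : (volumeVector p 4 : ℝ) = -4 * volumeVector p 0 := by
        rw [hv, hv, h4, h0]
        ring
      exact_mod_cast this
    funext k
    fin_cases k
    · rfl
    · exact key 1 h1
    · exact key 2 h2
    · exact key 3 h3
    · exact h4'

lemma hasSymmetricVolumeVector_of_dependence (hp : IsListing P p) (hP : IsLattice3Polytope P)
    (hc : IsAffineDependence p c) {a : ℝ} (h0 : c 0 = a) (h1 : c 1 = a) (h2 : c 2 = a)
    (h3 : c 3 = a) (h4 : c 4 = -4 * a) : ∃ q : ℤ, 1 ≤ q ∧ HasSymmetricVolumeVector P q := by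
  obtain ⟨q, hq0, hq⟩ := volumeVector_eq_of_dependence hp hP hc h0 h1 h2 h3 h4
  rcases lt_or_gt_of_ne hq0 with hneg | hpos
  -- Exchanging two points with equal coefficients keeps the shape of the vector and reverses its
  -- sign.
  · have hσ := (Equiv.swap (0 : Fin 5) 1).injective
    obtain ⟨q', -, hq'⟩ := volumeVector_eq_of_dependence (hp.comp hσ) hP (hc.comp hσ)
      (a := a) h1 h0 h2 h3 h4
    have e := volumeVector_comp_swap p
    rw [hq, hq'] at e
    change -4 * q' = -(-4 * q) at e
    exact ⟨q', by omega, _, hp.comp hσ, hq'⟩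
  · exact ⟨q, hpos, p, hp, hq⟩

/-- If `c 2 < a`, the lattice point `4 p 3 - p 0 - p 1 - p 4` lies strictly inside the segment from
`p 2` to `p 3`, where there is room for none of the five points. -/
lemma coeff_eq_of_lattice (hp : IsListing P p) (hP : IsLattice3Polytope P)
    (hc : IsAffineDependence p c) {a : ℝ} (ha : 0 < a) (h0 : c 0 = a) (h1 : c 1 = a)
    (h4 : c 4 = a) (h2 : 0 < c 2) (h2a : c 2 ≤ a) : c 2 = a := by
  by_contra hne
  have hlt : c 2 < a := lt_of_le_of_ne h2a hne
  set θ := c 2 / a with hθ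
  have hθ0 : 0 < θ := div_pos h2 ha
  have hθ1 : θ < 1 := (div_lt_one ha).2 hlt
  have hconv : Convex ℝ P := hp.eq_convexHull hP ▸ convex_convexHull ℝ _
  set x : Fin 3 → ℤ := (4 : ℤ) • p 3 - p 0 - p 1 - p 4 with hx
  have hxe : toReal3 x = θ • toReal3 (p 2) + (1 - θ) • toReal3 (p 3) := by
    have hs := hc.2.1
    have hs2 := hc.2.2
    rw [Fin.sum_univ_five, h0, h1, h4] at hs hs2
    have h3 : c 3 = -(3 * a + c 2) := by linarith
    have h2' : c 2 = a * θ := by rw [hθ]; field_simp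
    ext i
    have := congrFun hs2 i
    simp only [Pi.add_apply, Pi.smul_apply, smul_eq_mul, Pi.zero_apply] at this
    rw [h3, h2'] at this
    simp only [hx, toReal3_sub, toReal3_zsmul, Pi.add_apply, Pi.sub_apply, Pi.smul_apply,
      smul_eq_mul]
    push_cast
    refine mul_left_cancel₀ ha.ne' ?_
    linarith
  obtain ⟨k, hk⟩ := hp.exists_eq (z := x) (hxe ▸ hconv (hp.mem 2) (hp.mem 3) hθ0.le
    (by linarith) (by ring))
  rw [← hk] at hxe
  set d : Fin 5 → ℝ := fun i => (if i = k then 1 else 0) - (if i = 2 then θ else 0) -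
    (if i = 3 then 1 - θ else 0) with hd
  have hd1 : ∑ i, d i = 0 := by
    simp only [hd, Finset.sum_sub_distrib, Finset.sum_ite_eq', Finset.mem_univ, if_true]
    ring
  have hd2 : ∑ i, d i • toReal3 (p i) = 0 := by
    simp only [hd, sub_smul, ite_smul, zero_smul, one_smul, Finset.sum_sub_distrib,
      Finset.sum_ite_eq', Finset.mem_univ, if_true, hxe]
    module
  -- The relation `d` vanishes at an index where `c` does not, so it is trivial; but its entry at 2
  -- is `-θ` or `1 - θ`.
  obtain ⟨i, hik, hi⟩ : ∃ i : Fin 5, i ≠ k ∧ (i = 0 ∨ i = 1) :=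
    (by decide : ∀ k : Fin 5, ∃ i : Fin 5, i ≠ k ∧ (i = 0 ∨ i = 1)) k
  have hci : c i ≠ 0 := by
    rcases hi with rfl | rfl
    · rw [h0]; exact ha.ne'
    · rw [h1]; exact ha.ne'
  have hdi : d i = 0 := by
    rcases hi with rfl | rfl <;> simp [hd, hik]
  have := hp.dependence_unique hP hc hci hd1 hd2 2
  rw [hdi, zero_div, zero_mul] at this
  by_cases hk2 : 2 = k
  · simp [hd, hk2.symm] at this
    linarith
  · simp [hd, hk2] at this
    linarith

lemma hasSymmetricVolumeVector_of_takesValues (hp : IsListing P p) (hP : IsLattice3Polytope P)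
    (hc : IsDependenceWithNeg p c e) (hpos : ∀ k, k ≠ e → 0 < c k) (he : e = 2 ∨ e = 3)
    (hmax : ∀ l, l ≠ e → c l ≤ c 4) (hs : c 0 + c 1 + (-2 : ℝ) * c 4 = 0) :
    ∃ q : ℤ, 1 ≤ q ∧ HasSymmetricVolumeVector P q := by
  have hsum := hc.dep.2.1
  rw [Fin.sum_univ_five] at hsum
  have m0 := hmax 0 (by rcases he with rfl | rfl <;> decide)
  have m1 := hmax 1 (by rcases he with rfl | rfl <;> decide)
  have h4 := hpos 4 (by rcases he with rfl | rfl <;> decide)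
  have e0 : c 0 = c 4 := by linarith
  have e1 : c 1 = c 4 := by linarith
  rcases he with rfl | rfl
  · have hσ : Function.Injective (![0, 1, 3, 2, 4] : Fin 5 → Fin 5) := by decide
    have e3 : c 3 = c 4 := coeff_eq_of_lattice (hp.comp hσ) hP (hc.dep.comp hσ) h4 e0 e1 rfl
      (hpos 3 (by decide)) (hmax 3 (by decide))
    have hτ : Function.Injective (![0, 1, 3, 4, 2] : Fin 5 → Fin 5) := by decide
    exact hasSymmetricVolumeVector_of_dependence (hp.comp hτ) hP (hc.dep.comp hτ) e0 e1 e3 rfl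
      (show c 2 = -4 * c 4 by linarith)
  · have e2 : c 2 = c 4 := coeff_eq_of_lattice hp hP hc.dep h4 e0 e1 rfl
      (hpos 2 (by decide)) (hmax 2 (by decide))
    have hτ : Function.Injective (![0, 1, 2, 4, 3] : Fin 5 → Fin 5) := by decide
    exact hasSymmetricVolumeVector_of_dependence (hp.comp hτ) hP (hc.dep.comp hτ) e0 e1 e2 rfl
      (show c 3 = -4 * c 4 by linarith)

lemma isDependenceWithNeg_of_volumeVector {q : ℤ} (hq : 1 ≤ q)
    (hv : volumeVector p = ![q, q, q, q, -4 * q]) :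
    IsDependenceWithNeg p (fun k => (volumeVector p k : ℝ)) 4 := by
  have hq' : (0 : ℝ) < q := by exact_mod_cast hq
  have h4 : (volumeVector p 4 : ℝ) = -4 * q := by rw [hv]; simp
  have hk : ∀ k, k ≠ 4 → (volumeVector p k : ℝ) = q := by
    intro k hk
    rw [hv]
    fin_cases k <;> simp_all
  refine ⟨⟨fun h => ?_, sum_volumeVector p, sum_volumeVector_smul p⟩, ?_, fun k hk4 => ?_,
    fun k l _ hk4 hl4 => ?_⟩
  · have : (volumeVector p 0 : ℝ) = 0 := congrFun h 0
    rw [hk 0 (by decide)] at this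
    exact hq'.ne' this
  · rw [h4]
    linarith
  · rw [hk k hk4]
    exact hq'.le
  · rw [hk k hk4, hk l hl4]
    linarith

lemma hasSignature_four_one_of_volumeVector (hp : IsListing P p) {q : ℤ} (hq : 1 ≤ q)
    (hv : volumeVector p = ![q, q, q, q, -4 * q]) : HasSignature P 4 1 := by
  have hc := isDependenceWithNeg_of_volumeVector hq hv
  refine ⟨p, hp, _, hc.dep, ?_, ?_⟩
  · have : {k | 0 < (volumeVector p k : ℝ)} = ((Finset.univ.erase 4 : Finset (Fin 5)) : Set _) := by
      ext k
      rw [hv]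
      fin_cases k <;> simp <;> omega
    rw [this, Set.ncard_coe_finset]
    rfl
  · have : {k | (volumeVector p k : ℝ) < 0} = {4} := by
      ext k
      rw [hv]
      fin_cases k <;> simp <;> omega
    rw [this, Set.ncard_singleton]

theorem symmetric_iff (hP : IsLattice3Polytope P) {t : Fin 4 → Fin 3 → ℤ}
    (ht : IsLargestEmptyTetrahedron P t) {f : (Fin 3 → ℝ) →ᵃ[ℝ] ℝ} {h : ℤ}
    (hh : h = -1 ∨ h = -2) (hf : TakesValues P t f h) :
    (∃ q : ℤ, 1 ≤ q ∧ HasSymmetricVolumeVector P q) ↔ (HasSignature P 4 1 ∧ h = -2) := by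
  obtain ⟨-, p, hp, hpt, h0, h1, h2, h3, h4⟩ := hf
  have hrange : (Set.range fun j => p (Fin.succAbove 4 j)) = Set.range t := by
    rw [hp.range_succAbove, ← hp.image_compl, compl_four_eq, hpt]
  constructor
  · rintro ⟨q, hq, p', hp', hv⟩
    refine ⟨hasSignature_four_one_of_volumeVector hp' hq hv, ?_⟩
    obtain ⟨σ, rfl⟩ := hp'.exists_perm hp
    have hc := (isDependenceWithNeg_of_volumeVector hq hv).comp_perm σ
    have hc4 := hc.pos_of_isEmptyTetrahedron hp hP ht.1 hrange
    have hs := TakesValues.sum_eq hc.dep h0 h1 h2 h3 h4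
    have he := neg_index_eq hc hc4 hh hs
    have hk : ∀ k, k ≠ σ.symm 4 → (((fun k => (volumeVector p' k : ℝ)) ∘ σ) k) = q := by
      intro k hk
      have hk' : σ k ≠ 4 := fun h => hk (by rw [← h]; simp)
      simp only [Function.comp_apply, hv]
      generalize σ k = m at hk'
      fin_cases m <;> simp_all
    -- The indices 0, 1 and 4 all carry the coefficient `q`, so the relation reads `q + q + h * q =
    -- 0`.
    rw [hk 0 (by rcases he with he | he <;> rw [he] <;> decide),
      hk 1 (by rcases he with he | he <;> rw [he] <;> decide),
      hk 4 (by rcases he with he | he <;> rw [he] <;> decide)] at hs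
    rcases hh with rfl | rfl
    · exfalso
      push_cast at hs
      have hq' : (1 : ℝ) ≤ q := by exact_mod_cast hq
      linarith
    · rfl
  · rintro ⟨hsig, rfl⟩
    obtain ⟨c, e, hc, hpos⟩ := IsDependenceWithNeg.exists_of_signature_four_one hp hsig
    have hc4 := hc.pos_of_isEmptyTetrahedron hp hP ht.1 hrange
    have hs := TakesValues.sum_eq hc.dep h0 h1 h2 h3 h4
    exact hasSymmetricVolumeVector_of_takesValues hp hP hc hpos (neg_index_eq hc hc4 hh hs)
      (hc.le_of_isLargest hp hP ht hrange) (by simpa using hs)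

theorem eq_tetrahedronVolume_of_symmetric (hP : IsLattice3Polytope P) {t : Fin 4 → Fin 3 → ℤ}
    (ht : IsLargestEmptyTetrahedron P t) {q : ℤ} (hq : 1 ≤ q)
    (hsym : HasSymmetricVolumeVector P q) : q = tetrahedronVolume t := by
  obtain ⟨p, hp, hv⟩ := hsym
  obtain ⟨k, hk⟩ := hp.exists_range_succAbove ht.1 ht.2.1
  have hc := isDependenceWithNeg_of_volumeVector hq hv
  have hk0 : 0 < volumeVector p k := by
    exact_mod_cast hc.pos_of_isEmptyTetrahedron hp hP ht.1 hk
  rw [← tetrahedronVolume_eq_of_range_eq (IsDependenceWithNeg.injective_succAbove hp k) hk,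
    tetrahedronVolume_succAbove, abs_of_pos hk0]
  rw [hv] at hk0 ⊢
  fin_cases k
  · rfl
  · rfl
  · rfl
  · rfl
  · change 0 < -4 * q at hk0
    omega

end Main

theorem mainTheorem6 (P : Set (Fin 3 → ℝ)) (hP : IsLattice3Polytope P)
    (hsize : latticeSize P = 5) :
    ((HasSignature P 2 2 ∨ HasSignature P 2 1 ∨ HasSignature P 3 2) → HasWidth P 1) ∧
    ((HasSignature P 3 1 ∨ HasSignature P 4 1) →
      (∃ t, IsLargestEmptyTetrahedron P t) ∧
      ∀ t, IsLargestEmptyTetrahedron P t →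
        (∃ f, ∃ h : ℤ, (h = -1 ∨ h = -2) ∧ TakesValues P t f h) ∧
        (∀ f, ∀ h : ℤ, (h = -1 ∨ h = -2) → TakesValues P t f h →
          ((∃ q : ℤ, 1 ≤ q ∧ HasSymmetricVolumeVector P q) ↔
            (HasSignature P 4 1 ∧ h = -2))) ∧
        (∀ q : ℤ, 1 ≤ q → HasSymmetricVolumeVector P q → q = tetrahedronVolume t)) := by
  refine ⟨?_, fun h => ?_⟩
  · rintro (h | h | h)
    · exact hasWidth_one_of_signature_two_two hP h
    · exact hasWidth_one_of_signature_two_one hP h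
    · exact hasWidth_one_of_signature_three_two hP h
  · obtain ⟨p, hp⟩ : ∃ p, IsListing P p := by
      rcases h with ⟨p, hp, -⟩ | ⟨p, hp, -⟩ <;> exact ⟨p, hp⟩
    obtain ⟨c, e, hc⟩ := IsDependenceWithNeg.exists_of_signature hp h
    exact ⟨hc.exists_isLargest hp hP, fun t ht => ⟨exists_takesValues hp hP hc ht,
      fun f h hh hf => symmetric_iff hP ht hh hf,
      fun q hq hsym => eq_tetrahedronVolume_of_symmetric hP ht hq hsym⟩⟩
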